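/- Let $G$ be a finite-dimensional real Lie group with Lie algebra $\mathfrak g$, let $\langle\cdot,\cdot\rangle$ be the pairing of $\mathfrak g$ and $\mathfrak g^*$, and let $\mathrm{ad}_x y=[x,y]$, $\langle \mathrm{ad}^*_x\alpha,y\rangle=\langle\alpha,\mathrm{ad}_x y\rangle$. Let $\mathbb I(t):\mathfrak g\to\mathfrak g^*$ be invertible linear operators depending $C^1$ on $t$, with adjoints $\mathbb I^*:\mathfrak g\to\mathfrak g^*$, $\langle\mathbb I^*v,w\rangle=\langle\mathbb I w,v\rangle$, and put $\mathbb I^{-1*}=(\mathbb I^*)^{-1}:\mathfrak g^*\to\mathfrak g$. Let $\gamma(\xi,t)$ and $C(\Omega,\dot\Omega,\xi,\dot\xi,t)$ be real-valued functions, and let $$\lambda(\Omega,\xi,\dot\xi,t)=\frac{\frac{d}{dt}[\gamma(\xi,t)]-\big\langle\mathbb I\Omega,\ \frac{d}{dt}[\mathbb I^{-1*}\xi]+\mathrm{ad}_\Omega\mathbb I^{-1*}\xi\big\rangle}{\langle\xi,\mathbb I^{-1*}\xi\rangle},$$ where the total time derivatives are expanded by the chain rule. Fix $a$ and $\Omega_a,\Omega_b\in\mathfrak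 g$. For the problem of minimizing $\int_a^b C(\Omega,\dot\Omega,\xi,\dot\xi,t)\,dt$ over $\xi$ (and over $b$, if the terminal time is free) subject to $(\mathbb I\Omega)^{\cdot}-\mathrm{ad}^*_\Omega\mathbb I\Omega=\lambda\xi$, $\Omega(a)=\Omega_a$, $\Omega(b)=\Omega_b$, consider the performance index $$S=\langle\rho,\Omega(a)-\Omega_a\rangle+\langle\nu,\Omega(b)-\Omega_b\rangle+\int_a^b\Big[C+\big\langle\kappa,(\mathbb I\Omega)^{\cdot}-\mathrm{ad}^*_\Omega\mathbb I\Omega-\lambda\xi\big\rangle\Big]dt .$$ Let $b>a$, let $\Omega:\mathbb R\to\mathfrak g$ and $\xi:\mathbb R\to\mathfrak g^*$ be $C^2$ and $\kappa:\mathbb R\to\mathfrak g$ be $C^1$, and suppose that for every $t\in[a,b]$ we have $\langle\xi,\mathbb I^{-1*}\xi\rangle\ne0$, that $\gamma$ is $C^2$ near $(\xi(t),t)$, and that $C$ is $C^2$ near $(\Omega,\dot\Omega,\xi,\dot\xi,t)$. (1) (Fixed terminal time.) There are $\rho,\nu\in\mathfrak g^*$ such that $dS=0$ at $(\kappa,\Omega,\xi,\rho,\nu)$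 for all smooth variations $\delta\kappa,\delta\Omega,\delta\xi$ with $\delta\Omega(a)=0$ and all $d\rho,d\nu$, if and only if the following two-point boundary value problem holds: for $a\le t\le b$, $$(\mathbb I\Omega)^{\cdot}-\mathrm{ad}^*_\Omega\mathbb I\Omega-\lambda\xi=0,$$ $$\frac{\partial C}{\partial\Omega}-\frac{d}{dt}\frac{\partial C}{\partial\dot\Omega}-\mathbb I^*(\dot\kappa+\mathrm{ad}_\Omega\kappa)+\mathrm{ad}^*_\kappa\mathbb I\Omega-\frac{\partial\lambda}{\partial\Omega}\langle\kappa,\xi\rangle=0,$$ $$-\frac{d}{dt}\Big(\frac{\partial C}{\partial\dot\xi}-\langle\kappa,\xi\rangle\frac{\partial\lambda}{\partial\dot\xi}\Big)+\Big(\frac{\partial C}{\partial\xi}-\langle\kappa,\xi\rangle\frac{\partial\lambda}{\partial\xi}\Big)-\lambda\kappa=0,$$ together with $\Omega(a)=\Omega_a$, $\Omega(b)=\Omega_b$ and $$\Big[\frac{\partial C}{\partial\dot\xi}-\langle\kappa,\xi\rangle\frac{\partial\lambda}{\partial\dot\xi}\Big]_{t=a}=0,\qquad\Big[\frac{\partial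 C}{\partial\dot\xi}-\langle\kappa,\xi\rangle\frac{\partial\lambda}{\partial\dot\xi}\Big]_{t=b}=0 .$$ (2) (Free terminal time.) There are $\rho,\nu\in\mathfrak g^*$ such that $dS=0$ at $(\kappa,\Omega,\xi,\rho,\nu,b)$ for all variations as in (1) and all $db\in\mathbb R$, if and only if the boundary value problem of (1) holds together with $$\Big[C-\Big\langle\frac{\partial C}{\partial\dot\Omega},\dot\Omega\Big\rangle-\big\langle\kappa,-\dot{\mathbb I}\,\Omega+\mathrm{ad}^*_\Omega\mathbb I\Omega+\lambda\xi\big\rangle\Big]_{t=b}=0 .$$ Here $dS$ in the direction $(\delta\kappa,\delta\Omega,\delta\xi,d\rho,d\nu,db)$ is the derivative at $\varepsilon=0$ of $S$ at $(\kappa+\varepsilon\delta\kappa,\Omega+\varepsilon\delta\Omega,\xi+\varepsilon\delta\xi,\rho+\varepsilon d\rho,\nu+\varepsilon d\nu,b+\varepsilon db)$. -/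

import Mathlib

open scoped ContDiff Manifold Topology

noncomputable section

namespace Suslov

section LieAlgebra

variable {E : Type*} [NormedAddCommGroup E] [NormedSpace ℝ E]
  {H : Type*} [TopologicalSpace H] (I : ModelWithCorners ℝ E H)
  (G : Type*) [TopologicalSpace G] [ChartedSpace H G] [Group G]

/-- The Lie algebra `𝔤 = T₁G` of the Lie group `G` is, as a vector space, the model space `E` of
`G` (this is Mathlib's definition of a tangent space). This is the resulting identification; it
lets us use the norm of `E` on `𝔤`. -/
def toLie : E ≃ₗ[ℝ] GroupLieAlgebra I G where
  toFun x := x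
  invFun x := x
  map_add' _ _ := rfl
  map_smul' _ _ := rfl
  left_inv _ := rfl
  right_inv _ := rfl

variable [FiniteDimensional ℝ E] [LieGroup I (minSmoothness ℝ 3) G]

/-- `ad_x y = [x, y]`, the bracket of the Lie algebra of the Lie group `G`. -/
def ad (x : E) : E →L[ℝ] E :=
  LinearMap.toContinuousLinearMap
    ((toLie I G).symm.toLinearMap ∘ₗ
      LieAlgebra.ad ℝ (GroupLieAlgebra I G) (toLie I G x) ∘ₗ
        (toLie I G).toLinearMap)

/-- `⟨ad*_x α, y⟩ = ⟨α, ad_x y⟩`. -/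
def adStar (x : E) (α : StrongDual ℝ E) : StrongDual ℝ E := α.comp (ad I G x)

theorem ad_apply (x y : E) :
    ad I G x y = (toLie I G).symm ⁅toLie I G x, toLie I G y⁆ := rfl

end LieAlgebra

section Adjoint

variable {E : Type*} [NormedAddCommGroup E] [NormedSpace ℝ E]

/-- The adjoint `A* : 𝔤 → 𝔤*` of `A : 𝔤 → 𝔤*`, that is `⟨A* v, w⟩ = ⟨A w, v⟩`. -/
def adjoint (A : E ≃L[ℝ] StrongDual ℝ E) : E →L[ℝ] StrongDual ℝ E :=
  (A : E →L[ℝ] StrongDual ℝ E).flip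

/-- `A⁻¹* : 𝔤* → 𝔤`, the inverse of the adjoint `A*`, or equivalently the adjoint of the inverse
`A⁻¹ : 𝔤* → 𝔤`, see `apply_invAdjoint`. -/
def invAdjoint (A : E ≃L[ℝ] StrongDual ℝ E) : StrongDual ℝ E →L[ℝ] E := (adjoint A).inverse

variable [FiniteDimensional ℝ E]

theorem adjoint_isInvertible (A : E ≃L[ℝ] StrongDual ℝ E) : (adjoint A).IsInvertible := by
  have hinj : Function.Injective (adjoint A).toLinearMap := by
    rw [← LinearMap.ker_eq_bot, LinearMap.ker_eq_bot']
    intro v hv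
    by_contra hne
    obtain ⟨g, -, hg⟩ := exists_dual_vector ℝ v (norm_ne_zero_iff.mpr hne)
    have h1 : (adjoint A) v (A.symm g) = 0 := by
      have : (adjoint A) v = 0 := hv
      rw [this]; rfl
    have h2 : (adjoint A) v (A.symm g) = g v := by simp [adjoint]
    rw [h1] at h2
    rw [hg] at h2
    exact hne (by simpa using h2.symm)
  have hdim : Module.finrank ℝ E = Module.finrank ℝ (StrongDual ℝ E) :=
    A.toLinearEquiv.finrank_eq
  refine ⟨(LinearEquiv.ofInjectiveOfFinrankEq
    (adjoint A).toLinearMap hinj hdim).toContinuousLinearEquiv, ?_⟩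
  ext v w
  rfl

/-- `⟨α, A⁻¹* ξ⟩ = ⟨ξ, A⁻¹ α⟩`: the map `invAdjoint A` is the adjoint of `A⁻¹`. -/
theorem apply_invAdjoint (A : E ≃L[ℝ] StrongDual ℝ E) (α ξ : StrongDual ℝ E) :
    α (invAdjoint A ξ) = ξ (A.symm α) := by
  have h : adjoint A (invAdjoint A ξ) = ξ := by
    obtain ⟨B, hB⟩ := adjoint_isInvertible A
    rw [invAdjoint, ← hB, ContinuousLinearMap.inverse_equiv]
    exact B.apply_symm_apply ξ
  have h' := congrArg (fun f : StrongDual ℝ E => f (A.symm α)) h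
  simpa [adjoint] using h'

/-- `t ↦ A(t)⁻¹*` is differentiable where `t ↦ A(t)` is. -/
theorem differentiableAt_invAdjoint {A : ℝ → E ≃L[ℝ] StrongDual ℝ E} {t : ℝ}
    (hA : DifferentiableAt ℝ (fun s => (A s : E →L[ℝ] StrongDual ℝ E)) t) :
    DifferentiableAt ℝ (fun s => invAdjoint (A s)) t := by
  have hg : DifferentiableAt ℝ (fun B : E →L[ℝ] StrongDual ℝ E =>
      (ContinuousLinearMap.flip B : E →L[ℝ] StrongDual ℝ E))
      (A t : E →L[ℝ] StrongDual ℝ E) :=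
    (ContinuousLinearMap.flipₗᵢ ℝ E E
      ℝ).toContinuousLinearEquiv.toContinuousLinearMap.differentiableAt
  have hflip : DifferentiableAt ℝ (fun s => adjoint (A s)) t :=
    DifferentiableAt.fun_comp' (𝕜 := ℝ) (E := ℝ) (F := E →L[ℝ] StrongDual ℝ E)
      (G := E →L[ℝ] StrongDual ℝ E) (f := fun s => (A s : E →L[ℝ] StrongDual ℝ E))
      (g := fun B => ContinuousLinearMap.flip B) t hg hA
  obtain ⟨B, hB⟩ := adjoint_isInvertible (A t)
  have hinv : DifferentiableAt ℝ (ContinuousLinearMap.inverse :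
      (E →L[ℝ] StrongDual ℝ E) → StrongDual ℝ E →L[ℝ] E) (adjoint (A t)) := by
    rw [← hB]
    exact (contDiffAt_map_inverse (n := 1) B).differentiableAt (by norm_num)
  exact DifferentiableAt.fun_comp' (𝕜 := ℝ) (E := ℝ) (F := E →L[ℝ] StrongDual ℝ E)
    (G := StrongDual ℝ E →L[ℝ] E) (f := fun s => adjoint (A s))
    (g := ContinuousLinearMap.inverse) t hinv hflip

end Adjoint

/-- The data of the optimal control problem for Suslov's problem, with `𝔤 = E`:
the (possibly time-dependent) invertible inertia operator `𝕀(t) : 𝔤 → 𝔤*`, the right-hand side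
`γ(ξ, t)` of the constraint `⟨ξ, Ω⟩ = γ(ξ, t)`, the cost function `C(Ω, Ω̇, ξ, ξ̇, t)`, the
initial time `a`, and the prescribed values `Ω_a`, `Ω_b`. -/
structure ControlProblem (E : Type*) [NormedAddCommGroup E] [NormedSpace ℝ E] where
  inertia : ℝ → E ≃L[ℝ] StrongDual ℝ E
  γ : StrongDual ℝ E × ℝ → ℝ
  C : E × E × StrongDual ℝ E × StrongDual ℝ E × ℝ → ℝ
  a : ℝ
  Ωa : E
  Ωb : E

namespace ControlProblem

variable {E : Type*} [NormedAddCommGroup E] [NormedSpace ℝ E] [FiniteDimensional ℝ E]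
  {H : Type*} [TopologicalSpace H] (I : ModelWithCorners ℝ E H)
  (G : Type*) [TopologicalSpace G] [ChartedSpace H G] [Group G]
  [LieGroup I (minSmoothness ℝ 3) G] (P : ControlProblem E)

/-- The explicit Lagrange multiplier
`λ = (d/dt[γ(ξ,t)] - ⟨𝕀 Ω, d/dt[𝕀⁻¹* ξ] + ad_Ω 𝕀⁻¹* ξ⟩) / ⟨ξ, 𝕀⁻¹* ξ⟩`
as a function of `Ω`, `ξ`, `ξ' = dξ/dt` and `t`; the total time derivatives are expanded by the
chain rule, see `multiplier_along`. -/
def multiplier (Ω : E) (ξ ξ' : StrongDual ℝ E) (t : ℝ) : ℝ :=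
  (fderiv ℝ P.γ (ξ, t) (ξ', 1)
      - P.inertia t Ω
        ((deriv (fun s => invAdjoint (P.inertia s) ξ) t + invAdjoint (P.inertia t) ξ')
          + ad I G Ω (invAdjoint (P.inertia t) ξ)))
    / ξ (invAdjoint (P.inertia t) ξ)

/-- Along curves, `multiplier` is the quotient written with total time derivatives. -/
theorem multiplier_along {Ω : ℝ → E} {ξ : ℝ → StrongDual ℝ E} {t : ℝ}
    (hξ : DifferentiableAt ℝ ξ t) (hγ : DifferentiableAt ℝ P.γ (ξ t, t))
    (hI : DifferentiableAt ℝ (fun s => (P.inertia s : E →L[ℝ] StrongDual ℝ E)) t) :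
    P.multiplier I G (Ω t) (ξ t) (deriv ξ t) t =
      (deriv (fun s => P.γ (ξ s, s)) t
          - P.inertia t (Ω t)
            (deriv (fun s => invAdjoint (P.inertia s) (ξ s)) t
              + ad I G (Ω t) (invAdjoint (P.inertia t) (ξ t))))
        / ξ t (invAdjoint (P.inertia t) (ξ t)) := by
  have h1 : HasDerivAt (fun s => P.γ (ξ s, s)) (fderiv ℝ P.γ (ξ t, t) (deriv ξ t, 1)) t :=
    hγ.hasFDerivAt.comp_hasDerivAt (f := fun s => (ξ s, s)) t
      (hξ.hasDerivAt.prodMk (hasDerivAt_id t))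
  have h2 := differentiableAt_invAdjoint hI
  have h4 : HasDerivAt (fun s => invAdjoint (P.inertia s) (ξ s))
      (deriv (fun s => invAdjoint (P.inertia s)) t (ξ t)
        + invAdjoint (P.inertia t) (deriv ξ t)) t :=
    HasDerivAt.clm_apply (c := fun s => invAdjoint (P.inertia s)) (u := ξ)
      h2.hasDerivAt hξ.hasDerivAt
  have h3 : HasDerivAt (fun s => invAdjoint (P.inertia s) (ξ t))
      (deriv (fun s => invAdjoint (P.inertia s)) t (ξ t)) t := by
    have h := HasDerivAt.clm_apply (c := fun s => invAdjoint (P.inertia s))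
      (u := fun _ => ξ t) h2.hasDerivAt (hasDerivAt_const t (ξ t))
    rwa [map_zero, add_zero] at h
  rw [multiplier, h1.deriv, h3.deriv, h4.deriv]

/-- The left-hand side `(𝕀Ω)˙ - ad*_Ω 𝕀Ω - λ ξ` of the Euler–Poincaré–Suslov equation. -/
def residual (Ω : ℝ → E) (ξ : ℝ → StrongDual ℝ E) (t : ℝ) : StrongDual ℝ E :=
  deriv (fun s => P.inertia s (Ω s)) t - adStar I G (Ω t) (P.inertia t (Ω t))
    - P.multiplier I G (Ω t) (ξ t) (deriv ξ t) t • ξ t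

/-- The performance index
`S = ⟨ρ, Ω(a) - Ω_a⟩ + ⟨ν, Ω(b) - Ω_b⟩ + ∫_a^b [C + ⟨κ, (𝕀Ω)˙ - ad*_Ω 𝕀Ω - λ ξ⟩] dt`. -/
def performanceIndex (κ Ω : ℝ → E) (ξ : ℝ → StrongDual ℝ E) (ρ ν : StrongDual ℝ E) (b : ℝ) : ℝ :=
  ρ (Ω P.a - P.Ωa) + ν (Ω b - P.Ωb)
    + ∫ t in P.a..b,
        (P.C (Ω t, deriv Ω t, ξ t, deriv ξ t, t) + P.residual I G Ω ξ t (κ t))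

/-- `dS = 0` in the direction `(δκ, δΩ, δξ, dρ, dν, db)`. -/
def DifferentialVanishes (κ Ω : ℝ → E) (ξ : ℝ → StrongDual ℝ E) (ρ ν : StrongDual ℝ E) (b : ℝ)
    (δκ δΩ : ℝ → E) (δξ : ℝ → StrongDual ℝ E) (dρ dν : StrongDual ℝ E) (db : ℝ) : Prop :=
  HasDerivAt (fun ε : ℝ => P.performanceIndex I G (κ + ε • δκ) (Ω + ε • δΩ) (ξ + ε • δξ)
    (ρ + ε • dρ) (ν + ε • dν) (b + ε * db)) 0 0

/-- Stationarity of `S` when the terminal time is fixed: `dS = 0` for all smooth `δκ`, `δΩ`, `δξ`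
with `δΩ(a) = 0` and all `dρ`, `dν`, while `db = 0`. -/
def IsStationaryFixedTime (κ Ω : ℝ → E) (ξ : ℝ → StrongDual ℝ E) (ρ ν : StrongDual ℝ E)
    (b : ℝ) : Prop :=
  ∀ (δκ δΩ : ℝ → E) (δξ : ℝ → StrongDual ℝ E) (dρ dν : StrongDual ℝ E),
    ContDiff ℝ ∞ δκ → ContDiff ℝ ∞ δΩ → ContDiff ℝ ∞ δξ → δΩ P.a = 0 →
      P.DifferentialVanishes I G κ Ω ξ ρ ν b δκ δΩ δξ dρ dν 0

/-- Stationarity of `S` when the terminal time is free: `dS = 0` for all smooth `δκ`, `δΩ`, `δξ`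
with `δΩ(a) = 0` and all `dρ`, `dν`, `db`. -/
def IsStationaryFreeTime (κ Ω : ℝ → E) (ξ : ℝ → StrongDual ℝ E) (ρ ν : StrongDual ℝ E)
    (b : ℝ) : Prop :=
  ∀ (δκ δΩ : ℝ → E) (δξ : ℝ → StrongDual ℝ E) (dρ dν : StrongDual ℝ E) (db : ℝ),
    ContDiff ℝ ∞ δκ → ContDiff ℝ ∞ δΩ → ContDiff ℝ ∞ δξ → δΩ P.a = 0 →
      P.DifferentialVanishes I G κ Ω ξ ρ ν b δκ δΩ δξ dρ dν db

/-! Partial derivatives along a pair of curves `Ω(t)`, `ξ(t)`. Derivatives with respect to `Ω`,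
`Ω̇` lie in `𝔤*`, derivatives with respect to `ξ`, `ξ̇` lie in `𝔤** = 𝔤`. -/

/-- `∂C/∂Ω` -/
def costΩ (Ω : ℝ → E) (ξ : ℝ → StrongDual ℝ E) (t : ℝ) : StrongDual ℝ E :=
  fderiv ℝ (fun x => P.C (x, deriv Ω t, ξ t, deriv ξ t, t)) (Ω t)

/-- `∂C/∂Ω̇` -/
def costΩdot (Ω : ℝ → E) (ξ : ℝ → StrongDual ℝ E) (t : ℝ) : StrongDual ℝ E :=
  fderiv ℝ (fun v => P.C (Ω t, v, ξ t, deriv ξ t, t)) (deriv Ω t)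

/-- `∂C/∂ξ` -/
def costξ (Ω : ℝ → E) (ξ : ℝ → StrongDual ℝ E) (t : ℝ) : StrongDual ℝ (StrongDual ℝ E) :=
  fderiv ℝ (fun η => P.C (Ω t, deriv Ω t, η, deriv ξ t, t)) (ξ t)

/-- `∂C/∂ξ̇` -/
def costξdot (Ω : ℝ → E) (ξ : ℝ → StrongDual ℝ E) (t : ℝ) : StrongDual ℝ (StrongDual ℝ E) :=
  fderiv ℝ (fun u => P.C (Ω t, deriv Ω t, ξ t, u, t)) (deriv ξ t)

/-- `∂λ/∂Ω` -/
def multiplierΩ (Ω : ℝ → E) (ξ : ℝ → StrongDual ℝ E) (t : ℝ) : StrongDual ℝ E :=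
  fderiv ℝ (fun x => P.multiplier I G x (ξ t) (deriv ξ t) t) (Ω t)

/-- `∂λ/∂ξ` -/
def multiplierξ (Ω : ℝ → E) (ξ : ℝ → StrongDual ℝ E) (t : ℝ) : StrongDual ℝ (StrongDual ℝ E) :=
  fderiv ℝ (fun η => P.multiplier I G (Ω t) η (deriv ξ t) t) (ξ t)

/-- `∂λ/∂ξ̇` -/
def multiplierξdot (Ω : ℝ → E) (ξ : ℝ → StrongDual ℝ E) (t : ℝ) :
    StrongDual ℝ (StrongDual ℝ E) :=
  fderiv ℝ (fun u => P.multiplier I G (Ω t) (ξ t) u t) (deriv ξ t)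

/-- `∂C/∂ξ̇ - ⟨κ, ξ⟩ ∂λ/∂ξ̇` -/
def controlMomentum (κ Ω : ℝ → E) (ξ : ℝ → StrongDual ℝ E) (t : ℝ) :
    StrongDual ℝ (StrongDual ℝ E) :=
  P.costξdot Ω ξ t - ξ t (κ t) • P.multiplierξdot I G Ω ξ t

/-- The two-point boundary value problem on `[a, b]` formed by the optimally controlled equations
of motion, without the condition for a free terminal time. -/
structure IsOptimallyControlled (κ Ω : ℝ → E) (ξ : ℝ → StrongDual ℝ E) (b : ℝ) : Prop where
  /-- `(𝕀Ω)˙ - ad*_Ω 𝕀Ω - λ ξ = 0` -/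
  state : ∀ t ∈ Set.Icc P.a b,
    deriv (fun s => P.inertia s (Ω s)) t - adStar I G (Ω t) (P.inertia t (Ω t))
      - P.multiplier I G (Ω t) (ξ t) (deriv ξ t) t • ξ t = 0
  /-- `∂C/∂Ω - d/dt ∂C/∂Ω̇ - 𝕀*(κ̇ + ad_Ω κ) + ad*_κ 𝕀Ω - ⟨κ, ξ⟩ ∂λ/∂Ω = 0` -/
  costate : ∀ t ∈ Set.Icc P.a b,
    P.costΩ Ω ξ t - deriv (P.costΩdot Ω ξ) t
      - adjoint (P.inertia t) (deriv κ t + ad I G (Ω t) (κ t))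
      + adStar I G (κ t) (P.inertia t (Ω t)) - ξ t (κ t) • P.multiplierΩ I G Ω ξ t = 0
  /-- `-d/dt(∂C/∂ξ̇ - ⟨κ, ξ⟩ ∂λ/∂ξ̇) + (∂C/∂ξ - ⟨κ, ξ⟩ ∂λ/∂ξ) - λ κ = 0` in `𝔤** = 𝔤` -/
  control : ∀ t ∈ Set.Icc P.a b,
    -deriv (P.controlMomentum I G κ Ω ξ) t
      + (P.costξ Ω ξ t - ξ t (κ t) • P.multiplierξ I G Ω ξ t)
      - P.multiplier I G (Ω t) (ξ t) (deriv ξ t) t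
        • NormedSpace.inclusionInDoubleDual ℝ E (κ t) = 0
  left_state : Ω P.a = P.Ωa
  left_control : P.controlMomentum I G κ Ω ξ P.a = 0
  right_state : Ω b = P.Ωb
  right_control : P.controlMomentum I G κ Ω ξ b = 0

/-- The transversality condition for a free terminal time,
`[C - ⟨∂C/∂Ω̇, Ω̇⟩ - ⟨κ, -𝕀̇ Ω + ad*_Ω 𝕀Ω + λ ξ⟩]_{t = b} = 0`. -/
def Transversality (κ Ω : ℝ → E) (ξ : ℝ → StrongDual ℝ E) (b : ℝ) : Prop :=
  P.C (Ω b, deriv Ω b, ξ b, deriv ξ b, b) - P.costΩdot Ω ξ b (deriv Ω b)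
    - (-(deriv (fun s => (P.inertia s : E →L[ℝ] StrongDual ℝ E)) b (Ω b))
        + adStar I G (Ω b) (P.inertia b (Ω b))
        + P.multiplier I G (Ω b) (ξ b) (deriv ξ b) b • ξ b) (κ b) = 0

end ControlProblem

end Suslov

end

set_option linter.unusedSectionVars false

noncomputable section

namespace Suslov

section VariationalCalculus

variable {X : Type*} [NormedAddCommGroup X] [NormedSpace ℝ X]

theorem isOpen_setOf_contDiffAt (L : X → ℝ) : IsOpen {x | ContDiffAt ℝ 1 L x} :=
  isOpen_iff_eventually.mpr fun x hx =>
    ContDiffAt.eventually (show ContDiffAt ℝ 1 L x from hx) (by simp)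

theorem hasDerivAt_comp_add_smul {L : X → ℝ} {x v : X} {ε : ℝ}
    (hL : DifferentiableAt ℝ L (x + ε • v)) :
    HasDerivAt (fun s : ℝ => L (x + s • v)) (fderiv ℝ L (x + ε • v) v) ε := by
  have h : HasDerivAt (fun s : ℝ => x + s • v) v ε := by
    simpa using ((hasDerivAt_id ε).smul_const v).const_add x
  exact hL.hasFDerivAt.comp_hasDerivAt (f := fun s : ℝ => x + s • v) ε h

/-- Differentiation under the integral sign along the segment `c + ε δ`. -/
theorem hasDerivAt_integral_comp_add_smul {L : X → ℝ} {c δ : ℝ → X} {a b : ℝ} (hab : a ≤ b)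
    (hc : Continuous c) (hδ : Continuous δ)
    (hL : ∀ t ∈ Set.Icc a b, ContDiffAt ℝ 1 L (c t)) :
    HasDerivAt (fun ε : ℝ => ∫ t in a..b, L (c t + ε • δ t))
      (∫ t in a..b, fderiv ℝ L (c t) (δ t)) 0 := by
  have hcont : Continuous fun p : ℝ × ℝ => c p.2 + p.1 • δ p.2 := by fun_prop
  obtain ⟨u, v, hu, -, h0u, hv, huv⟩ := generalized_tube_lemma (isCompact_singleton (x := (0 : ℝ)))
    (isCompact_Icc (a := a) (b := b)) ((isOpen_setOf_contDiffAt L).preimage hcont) (by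
      rintro ⟨ε, t⟩ ⟨hε, ht⟩
      rw [Set.mem_singleton_iff] at hε
      subst hε
      simpa using hL t ht)
  obtain ⟨r, hr, hru⟩ := Metric.nhds_basis_closedBall.mem_iff.mp
    (hu.mem_nhds (h0u rfl))
  have hW : ∀ ε ∈ Metric.closedBall (0 : ℝ) r, ∀ t ∈ Set.Icc a b,
      ContDiffAt ℝ 1 L (c t + ε • δ t) := fun ε hε t ht =>
    huv (Set.mk_mem_prod (hru hε) (hv ht))
  have hF : ∀ ε ∈ Metric.closedBall (0 : ℝ) r,
      ContinuousOn (fun t => L (c t + ε • δ t)) (Set.Icc a b) := fun ε hε t ht =>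
    ((hW ε hε t ht).continuousAt.comp
      (f := fun t => c t + ε • δ t) (by fun_prop)).continuousWithinAt
  have hF' : ContinuousOn (fun p : ℝ × ℝ => fderiv ℝ L (c p.2 + p.1 • δ p.2) (δ p.2))
      (Metric.closedBall (0 : ℝ) r ×ˢ Set.Icc a b) := by
    rintro ⟨ε, t⟩ ⟨hε, ht⟩
    have h1 : ContinuousAt (fun p : ℝ × ℝ => fderiv ℝ L (c p.2 + p.1 • δ p.2)) (ε, t) :=
      ((hW ε hε t ht).continuousAt_fderiv (by simp)).comp
        (f := fun p : ℝ × ℝ => c p.2 + p.1 • δ p.2) hcont.continuousAt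
    exact (h1.clm_apply (by fun_prop)).continuousWithinAt
  obtain ⟨M, hM⟩ := ((isCompact_closedBall (0 : ℝ) r).prod
    (isCompact_Icc (a := a) (b := b))).exists_bound_of_continuousOn hF'
  have hball : Metric.closedBall (0 : ℝ) r ∈ 𝓝 (0 : ℝ) := Metric.closedBall_mem_nhds 0 hr
  have h0 : (0 : ℝ) ∈ Metric.closedBall (0 : ℝ) r := Metric.mem_closedBall_self hr.le
  have hmeas : ∀ f : ℝ → ℝ, ContinuousOn f (Set.Icc a b) →
      MeasureTheory.AEStronglyMeasurable f
        (MeasureTheory.volume.restrict (Set.uIoc a b)) := fun f hf => by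
    rw [Set.uIoc_of_le hab]
    exact (hf.mono Set.Ioc_subset_Icc_self).aestronglyMeasurable measurableSet_Ioc
  have key := (intervalIntegral.hasDerivAt_integral_of_dominated_loc_of_deriv_le
    (μ := MeasureTheory.volume) (a := a) (b := b) (bound := fun _ => M)
    (F := fun ε t => L (c t + ε • δ t))
    (F' := fun ε t => fderiv ℝ L (c t + ε • δ t) (δ t)) hball
    (Filter.eventually_of_mem hball fun ε hε => hmeas _ (hF ε hε))
    ((hF 0 h0).intervalIntegrable_of_Icc hab)
    (hmeas _ (hF'.comp (f := fun t : ℝ => ((0 : ℝ), t)) (by fun_prop)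
      fun t ht => ⟨h0, ht⟩))
    (Filter.Eventually.of_forall fun t ht ε hε => hM (ε, t) ⟨hε, ?_⟩)
    intervalIntegrable_const
    (Filter.Eventually.of_forall fun t ht ε hε =>
      hasDerivAt_comp_add_smul ((hW ε hε t ?_).differentiableAt (by simp)))).2
  · simpa using key
  all_goals
    rw [Set.uIoc_of_le hab] at ht
    exact Set.Ioc_subset_Icc_self ht

/-- The contribution of a moving endpoint. -/
theorem hasDerivAt_integral_endpoint {F : ℝ → ℝ → ℝ} {b : ℝ}
    (hF : ∀ᶠ p in 𝓝 ((0 : ℝ), b), ContinuousAt (fun q : ℝ × ℝ => F q.1 q.2) p) (r : ℝ) :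
    HasDerivAt (fun ε : ℝ => ∫ t in b..(b + ε * r), F ε t) (r * F 0 b) 0 := by
  rw [hasDerivAt_iff_isLittleO, Asymptotics.isLittleO_iff]
  intro η hη
  have hη' : 0 < η / (|r| + 1) := by positivity
  have hclose : ∀ᶠ p in 𝓝 ((0 : ℝ), b), |F p.1 p.2 - F 0 b| ≤ η / (|r| + 1) := by
    have h := (hF.self_of_nhds).tendsto
    filter_upwards [h (Metric.closedBall_mem_nhds _ hη')] with p hp
    simpa [Real.dist_eq] using hp
  obtain ⟨ρ, hρ, hball⟩ := Metric.eventually_nhds_iff.mp (hF.and hclose)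
  have hsmall : ∀ᶠ ε in 𝓝 (0 : ℝ), |ε| < ρ ∧ |ε * r| < ρ := by
    have h1 : ContinuousAt (fun ε : ℝ => |ε|) 0 := by fun_prop
    have h2 : ContinuousAt (fun ε : ℝ => |ε * r|) 0 := by fun_prop
    exact (h1.eventually_lt continuousAt_const (by simpa using hρ)).and
      (h2.eventually_lt continuousAt_const (by simpa using hρ))
  filter_upwards [hsmall] with ε hε
  have hmem : ∀ t ∈ Set.uIcc b (b + ε * r), dist (ε, t) ((0 : ℝ), b) < ρ := by
    intro t ht
    have h1 := Set.abs_sub_left_of_mem_uIcc ht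
    rw [Prod.dist_eq, max_lt_iff]
    refine ⟨by simpa [Real.dist_eq] using hε.1, ?_⟩
    rw [Real.dist_eq]
    refine lt_of_le_of_lt h1 ?_
    simpa using hε.2
  have hcont : ContinuousOn (F ε) (Set.uIcc b (b + ε * r)) := fun t ht =>
    ((hball (hmem t ht)).1.comp (f := fun s : ℝ => (ε, s))
      (by fun_prop)).continuousWithinAt
  have hint : (∫ t in b..(b + ε * r), F ε t) - ε * (r * F 0 b)
      = ∫ t in b..(b + ε * r), (F ε t - F 0 b) := by
    rw [intervalIntegral.integral_sub hcont.intervalIntegrable intervalIntegrable_const]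
    simp
    ring
  have hle := intervalIntegral.norm_integral_le_of_norm_le_const
    (f := fun t => F ε t - F 0 b) (a := b) (b := b + ε * r) (C := η / (|r| + 1))
    fun t ht => (hball (hmem t (Set.uIoc_subset_uIcc ht))).2
  have hfin : η / (|r| + 1) * |b + ε * r - b| ≤ η * |ε| := by
    rw [add_sub_cancel_left, abs_mul]
    have h3 : |r| / (|r| + 1) ≤ 1 := by
      rw [div_le_one (by positivity)]; linarith
    calc η / (|r| + 1) * (|ε| * |r|) = η * |ε| * (|r| / (|r| + 1)) := by ring
      _ ≤ η * |ε| * 1 := by gcongr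
      _ = η * |ε| := mul_one _
  simp only [zero_mul, add_zero, intervalIntegral.integral_same, sub_zero, smul_eq_mul]
  rw [hint]
  exact hle.trans hfin

/-- The first variation of `∫_a^b L(c) dt` in the direction `δ`, with moving terminal time. -/
theorem hasDerivAt_action {L : X → ℝ} {c δ : ℝ → X} {a b : ℝ} (hab : a ≤ b)
    (hc : Continuous c) (hδ : Continuous δ)
    (hL : ∀ t ∈ Set.Icc a b, ContDiffAt ℝ 1 L (c t)) (r : ℝ) :
    HasDerivAt (fun ε : ℝ => ∫ t in a..(b + ε * r), L (c t + ε • δ t))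
      ((∫ t in a..b, fderiv ℝ L (c t) (δ t)) + r * L (c b)) 0 := by
  have hcont : Continuous fun p : ℝ × ℝ => c p.2 + p.1 • δ p.2 := by fun_prop
  have hev : ∀ t ∈ Set.Icc a b, ∀ᶠ p in 𝓝 ((0 : ℝ), t),
      ContDiffAt ℝ 1 L (c p.2 + p.1 • δ p.2) := fun t ht =>
    hcont.continuousAt.eventually (by simpa using (hL t ht).eventually (by simp))
  have hcontAt : ∀ p : ℝ × ℝ, ContDiffAt ℝ 1 L (c p.2 + p.1 • δ p.2) →
      ContinuousAt (fun q : ℝ × ℝ => L (c q.2 + q.1 • δ q.2)) p := fun p hp =>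
    hp.continuousAt.comp (f := fun q : ℝ × ℝ => c q.2 + q.1 • δ q.2) hcont.continuousAt
  have h1 := hasDerivAt_integral_comp_add_smul hab hc hδ hL
  have h2 := hasDerivAt_integral_endpoint (F := fun ε t => L (c t + ε • δ t)) (b := b)
    ((hev b (Set.right_mem_Icc.mpr hab)).mono hcontAt) r
  simp only [zero_smul, add_zero] at h2
  refine (h1.add h2).congr_of_eventuallyEq ?_
  obtain ⟨u, v, hu, hvo, h0u, hv, huv⟩ := generalized_tube_lemma
    (isCompact_singleton (x := (0 : ℝ))) (isCompact_Icc (a := a) (b := b))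
    ((isOpen_setOf_contDiffAt L).preimage hcont) (by
      rintro ⟨ε, t⟩ ⟨hε, ht⟩
      rw [Set.mem_singleton_iff] at hε
      subst hε
      simpa using hL t ht)
  obtain ⟨s, hs, hsv⟩ := Metric.mem_nhds_iff.mp
    (hvo.mem_nhds (hv (Set.right_mem_Icc.mpr hab)))
  have hsmall : ∀ᶠ ε in 𝓝 (0 : ℝ), |ε * r| < s :=
    ContinuousAt.eventually_lt (f := fun ε : ℝ => |ε * r|) (by fun_prop) continuousAt_const
      (by simpa using hs)
  filter_upwards [hu.mem_nhds (h0u rfl), hsmall] with ε hεu hεs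
  have hcv : ∀ t ∈ v, ContinuousAt (fun t => L (c t + ε • δ t)) t := fun t ht =>
    (hcontAt (ε, t) (huv (Set.mk_mem_prod hεu ht))).comp (f := fun s : ℝ => (ε, s)) (by fun_prop)
  refine (intervalIntegral.integral_add_adjacent_intervals ?_ ?_).symm
  · exact ContinuousOn.intervalIntegrable_of_Icc hab fun t ht =>
      (hcv t (hv ht)).continuousWithinAt
  · refine ContinuousOn.intervalIntegrable fun t ht => (hcv t (hsv ?_)).continuousWithinAt
    have := Set.abs_sub_left_of_mem_uIcc ht
    rw [Metric.mem_ball, Real.dist_eq]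
    refine lt_of_le_of_lt this ?_
    simpa using hεs

/-- The fundamental lemma of the calculus of variations. -/
theorem eq_zero_of_integral_apply_eq_zero {A : ℝ → StrongDual ℝ X} {a b : ℝ} (hab : a < b)
    (hA : ContinuousOn A (Set.Icc a b))
    (h : ∀ x : ℝ → X, ContDiff ℝ ∞ x → x a = 0 → x b = 0 → ∫ t in a..b, A t (x t) = 0) :
    ∀ t ∈ Set.Icc a b, A t = 0 := by
  intro t ht
  ext e
  have hcont : ContinuousOn (fun t => A t e) (Set.Icc a b) := hA.clm_apply continuousOn_const
  have hae : ∀ᵐ s : ℝ, s ∈ Set.Ioo a b → A s e = 0 := by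
    refine IsOpen.ae_eq_zero_of_integral_contDiff_smul_eq_zero (f := fun s => A s e) isOpen_Ioo
      ((hcont.mono Set.Ioo_subset_Icc_self).locallyIntegrableOn measurableSet_Ioo) ?_
    intro g hg _ hsupp
    have hg0 : ∀ s, s ∉ Set.Ioo a b → g s = 0 := fun s hs =>
      image_eq_zero_of_notMem_tsupport fun hs' => hs (hsupp hs')
    have h1 := h (fun s => g s • e) (hg.smul contDiff_const)
      (by simp [hg0 a (by simp)]) (by simp [hg0 b (by simp)])
    rw [intervalIntegral.integral_of_le hab.le,
      MeasureTheory.setIntegral_eq_integral_of_forall_compl_eq_zero] at h1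
    · simpa using h1
    · intro s hs
      rw [hg0 s fun hs' => hs (Set.Ioo_subset_Ioc_self hs')]
      simp
  have hIoo : Set.EqOn (fun t => A t e) (fun _ => 0) (Set.Ioo a b) := by
    refine MeasureTheory.Measure.eqOn_open_of_ae_eq (μ := MeasureTheory.volume) ?_ isOpen_Ioo
      (hcont.mono Set.Ioo_subset_Icc_self) continuousOn_const
    exact (MeasureTheory.ae_restrict_iff' measurableSet_Ioo).mpr hae
  have hIcc := hIoo.of_subset_closure hcont continuousOn_const Set.Ioo_subset_Icc_self
    (by rw [closure_Ioo hab.ne])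
  simpa using hIcc ht

theorem continuousOn_deriv_of_contDiffAt {f : ℝ → X} {s : Set ℝ}
    (hf : ∀ t ∈ s, ContDiffAt ℝ 1 f t) : ContinuousOn (deriv f) s := fun t ht =>
  (((hf t ht).continuousAt_fderiv (by simp)).clm_apply
    (continuousAt_const (y := (1 : ℝ)))).continuousWithinAt

/-- Integration by parts in the first variation: `f` and `p` are the derivatives of the integrand
with respect to position and velocity. -/
theorem integral_force_add_momentum {f g p : ℝ → StrongDual ℝ X} {x : ℝ → X} {a b : ℝ}
    (hab : a ≤ b) (hf : ContinuousOn f (Set.Icc a b))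
    (hp : ∀ t ∈ Set.Icc a b, ContDiffAt ℝ 1 p t)
    (hg : ∀ t ∈ Set.Icc a b, ∀ v, g t v = f t v - deriv p t v) (hx : ContDiff ℝ 1 x) :
    ∫ t in a..b, (f t (x t) + p t (deriv x t))
      = p b (x b) - p a (x a) + ∫ t in a..b, g t (x t) := by
  have hpc : ContinuousOn p (Set.Icc a b) := fun t ht =>
    (hp t ht).continuousAt.continuousWithinAt
  have hx' : Continuous (deriv x) := hx.continuous_deriv le_rfl
  have i1 : IntervalIntegrable (fun t => deriv p t (x t)) MeasureTheory.volume a b :=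
    ((continuousOn_deriv_of_contDiffAt hp).clm_apply
      hx.continuous.continuousOn).intervalIntegrable_of_Icc hab
  have i2 : IntervalIntegrable (fun t => p t (deriv x t)) MeasureTheory.volume a b :=
    (hpc.clm_apply hx'.continuousOn).intervalIntegrable_of_Icc hab
  have i3 : IntervalIntegrable (fun t => f t (x t)) MeasureTheory.volume a b :=
    (hf.clm_apply hx.continuous.continuousOn).intervalIntegrable_of_Icc hab
  have h := intervalIntegral.integral_eq_sub_of_hasDerivAt (a := a) (b := b)
    (f := fun t => p t (x t)) (f' := fun t => deriv p t (x t) + p t (deriv x t))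
    (fun t ht => by
      rw [Set.uIcc_of_le hab] at ht
      exact ((hp t ht).differentiableAt (by simp)).hasDerivAt.clm_apply
        (hx.differentiable (by simp) t).hasDerivAt) (i1.add i2)
  have hg' : ∫ t in a..b, g t (x t) = ∫ t in a..b, (f t (x t) - deriv p t (x t)) :=
    intervalIntegral.integral_congr fun t ht => by
      rw [Set.uIcc_of_le hab] at ht
      exact hg t ht (x t)
  rw [intervalIntegral.integral_add i1 i2] at h
  rw [hg', intervalIntegral.integral_add i3 i2, intervalIntegral.integral_sub i3 i1]
  linarith

end VariationalCalculus

section Inertia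

variable {E : Type*} [NormedAddCommGroup E] [NormedSpace ℝ E] [FiniteDimensional ℝ E]

theorem contDiff_flip : ContDiff ℝ 1 (fun B : E →L[ℝ] StrongDual ℝ E =>
    (ContinuousLinearMap.flip B : E →L[ℝ] StrongDual ℝ E)) :=
  ContinuousLinearMap.contDiff
    { toFun := fun B : E →L[ℝ] StrongDual ℝ E => (ContinuousLinearMap.flip B)
      map_add' := fun _ _ => rfl
      map_smul' := fun _ _ => rfl
      cont := by
        have h := (ContinuousLinearMap.flipₗᵢ ℝ E E ℝ).continuous
        rwa [ContinuousLinearMap.coe_flipₗᵢ] at h }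

theorem contDiff_adjoint {A : ℝ → E ≃L[ℝ] StrongDual ℝ E}
    (hA : ContDiff ℝ 1 (fun s => (A s : E →L[ℝ] StrongDual ℝ E))) :
    ContDiff ℝ 1 (fun s => adjoint (A s)) :=
  contDiff_flip.comp (f := fun s => (A s : E →L[ℝ] StrongDual ℝ E)) hA

theorem hasDerivAt_adjoint {A : ℝ → E ≃L[ℝ] StrongDual ℝ E}
    (hA : ContDiff ℝ 1 (fun s => (A s : E →L[ℝ] StrongDual ℝ E))) (t : ℝ) :
    HasDerivAt (fun s => adjoint (A s))
      (deriv (fun s => (A s : E →L[ℝ] StrongDual ℝ E)) t).flip t := by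
  have h1 := ((contDiff_adjoint hA).differentiable (by simp) t).hasDerivAt
  have h2 := (hA.differentiable (by simp) t).hasDerivAt
  refine h1.congr_deriv ?_
  ext v w
  have h1' : HasDerivAt (fun s => adjoint (A s) v) (deriv (fun s => adjoint (A s)) t v) t := by
    simpa using h1.clm_apply (hasDerivAt_const t v)
  have h2' : HasDerivAt (fun s => A s w)
      (deriv (fun s => (A s : E →L[ℝ] StrongDual ℝ E)) t w) t := by
    simpa using h2.clm_apply (hasDerivAt_const t w)
  have h1'' : HasDerivAt (fun s => adjoint (A s) v w)
      (deriv (fun s => adjoint (A s)) t v w) t := by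
    simpa using h1'.clm_apply (hasDerivAt_const t w)
  have h2'' : HasDerivAt (fun s => A s w v)
      (deriv (fun s => (A s : E →L[ℝ] StrongDual ℝ E)) t w v) t := by
    simpa using h2'.clm_apply (hasDerivAt_const t v)
  exact h1''.unique h2''

theorem contDiff_invAdjoint {A : ℝ → E ≃L[ℝ] StrongDual ℝ E}
    (hA : ContDiff ℝ 1 (fun s => (A s : E →L[ℝ] StrongDual ℝ E))) :
    ContDiff ℝ 1 (fun s => invAdjoint (A s)) := by
  have hflip := contDiff_adjoint hA
  rw [contDiff_iff_contDiffAt] at hflip ⊢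
  intro t
  obtain ⟨B, hB⟩ := adjoint_isInvertible (A t)
  have hinv : ContDiffAt ℝ 1 (ContinuousLinearMap.inverse :
      (E →L[ℝ] StrongDual ℝ E) → StrongDual ℝ E →L[ℝ] E) (adjoint (A t)) := by
    rw [← hB]
    exact contDiffAt_map_inverse (n := 1) B
  exact ContDiffAt.comp t (f := fun s => adjoint (A s)) (g := ContinuousLinearMap.inverse)
    hinv (hflip t)

/-- The values of `(t, 𝕀, 𝕀̇, 𝕀⁻¹*, (𝕀⁻¹*)˙)`. -/
def InertiaJet (E : Type*) [NormedAddCommGroup E] [NormedSpace ℝ E] : Type _ :=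
  ℝ × (E →L[ℝ] StrongDual ℝ E) × (E →L[ℝ] StrongDual ℝ E) ×
    (StrongDual ℝ E →L[ℝ] E) × (StrongDual ℝ E →L[ℝ] E)

namespace InertiaJet

instance : NormedAddCommGroup (InertiaJet E) :=
  inferInstanceAs (NormedAddCommGroup (ℝ × (E →L[ℝ] StrongDual ℝ E) ×
    (E →L[ℝ] StrongDual ℝ E) × (StrongDual ℝ E →L[ℝ] E) × (StrongDual ℝ E →L[ℝ] E)))

instance : NormedSpace ℝ (InertiaJet E) :=
  inferInstanceAs (NormedSpace ℝ (ℝ × (E →L[ℝ] StrongDual ℝ E) ×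
    (E →L[ℝ] StrongDual ℝ E) × (StrongDual ℝ E →L[ℝ] E) × (StrongDual ℝ E →L[ℝ] E)))

/-- The components of a jet. -/
def toProd (j : InertiaJet E) : ℝ × (E →L[ℝ] StrongDual ℝ E) × (E →L[ℝ] StrongDual ℝ E) ×
    (StrongDual ℝ E →L[ℝ] E) × (StrongDual ℝ E →L[ℝ] E) := j

/-- The jet with the given components. -/
def ofProd (j : ℝ × (E →L[ℝ] StrongDual ℝ E) × (E →L[ℝ] StrongDual ℝ E) ×
    (StrongDual ℝ E →L[ℝ] E) × (StrongDual ℝ E →L[ℝ] E)) : InertiaJet E := j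

@[fun_prop]
theorem contDiff_toProd : ContDiff ℝ 1 (toProd : InertiaJet E → _) := contDiff_id

@[fun_prop]
theorem continuous_ofProd : Continuous (ofProd : _ → InertiaJet E) := continuous_id

end InertiaJet

end Inertia

section Bracket

variable {E : Type*} [NormedAddCommGroup E] [NormedSpace ℝ E] [FiniteDimensional ℝ E]
  {H : Type*} [TopologicalSpace H] (I : ModelWithCorners ℝ E H)
  (G : Type*) [TopologicalSpace G] [ChartedSpace H G] [Group G]
  [LieGroup I (minSmoothness ℝ 3) G]

/-- The bracket as a continuous bilinear map. -/
def adL : E →L[ℝ] E →L[ℝ] E :=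
  LinearMap.toContinuousLinearMap
    { toFun := ad I G
      map_add' := fun x y => by ext z; simp [ad_apply]
      map_smul' := fun r x => by ext z; simp [ad_apply] }

theorem adL_apply (x : E) : adL I G x = ad I G x := rfl

theorem ad_skew (x y : E) : ad I G x y = -ad I G y x := by
  rw [ad_apply, ad_apply, ← lie_skew, map_neg]

end Bracket

namespace ControlProblem

variable {E : Type*} [NormedAddCommGroup E] [NormedSpace ℝ E] [FiniteDimensional ℝ E]
  {H : Type*} [TopologicalSpace H] (I : ModelWithCorners ℝ E H)
  (G : Type*) [TopologicalSpace G] [ChartedSpace H G] [Group G]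
  [LieGroup I (minSmoothness ℝ 3) G] (P : ControlProblem E)

/-- The multiplier as a function of `(Ω, ξ, ξ̇)` and `(t, 𝕀, 𝕀̇, 𝕀⁻¹*, (𝕀⁻¹*)˙)`. -/
def multiplierFun (x : E × StrongDual ℝ E × StrongDual ℝ E × InertiaJet E) : ℝ :=
  (fderiv ℝ P.γ (x.2.1, x.2.2.2.toProd.1) (x.2.2.1, 1)
      - x.2.2.2.toProd.2.1 x.1
        ((x.2.2.2.toProd.2.2.2.2 x.2.1 + x.2.2.2.toProd.2.2.2.1 x.2.2.1)
          + adL I G x.1 (x.2.2.2.toProd.2.2.2.1 x.2.1)))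
    / x.2.1 (x.2.2.2.toProd.2.2.2.1 x.2.1)

theorem contDiffAt_multiplierFun {x : E × StrongDual ℝ E × StrongDual ℝ E × InertiaJet E}
    (hγ : ContDiffAt ℝ 2 P.γ (x.2.1, x.2.2.2.toProd.1))
    (hden : x.2.1 (x.2.2.2.toProd.2.2.2.1 x.2.1) ≠ 0) :
    ContDiffAt ℝ 1 (P.multiplierFun I G) x := by
  have h1 : ContDiffAt ℝ 1 (fun y : E × StrongDual ℝ E × StrongDual ℝ E × InertiaJet E =>
        fderiv ℝ P.γ (y.2.1, y.2.2.2.toProd.1)) x :=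
    ContDiffAt.comp x (g := fderiv ℝ P.γ)
      (f := fun y : E × StrongDual ℝ E × StrongDual ℝ E × InertiaJet E =>
        (y.2.1, y.2.2.2.toProd.1)) (hγ.fderiv_right (by norm_num)) (by fun_prop)
  refine ContDiffAt.div (ContDiffAt.sub (h1.clm_apply (by fun_prop)) ?_) (by fun_prop) hden
  fun_prop

/-- The integrand of the performance index as a function of
`(κ, Ω, Ω̇, ξ, ξ̇)` and `(t, 𝕀, 𝕀̇, 𝕀⁻¹*, (𝕀⁻¹*)˙)`. -/
def lagrangian (x : E × E × E × StrongDual ℝ E × StrongDual ℝ E × InertiaJet E) : ℝ :=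
  match x with
  | (k, w, v, η, u, j) =>
    P.C (w, v, η, u, j.toProd.1) + (j.toProd.2.2.1 w k + j.toProd.2.1 v k
      - j.toProd.2.1 w (adL I G w k) - P.multiplierFun I G (w, η, u, j) * η k)

/-- The jet of the inertia operator at time `t`. -/
def jet (t : ℝ) : InertiaJet E :=
  InertiaJet.ofProd (t, P.inertia t, deriv (fun s => (P.inertia s : E →L[ℝ] StrongDual ℝ E)) t,
    invAdjoint (P.inertia t), deriv (fun s => invAdjoint (P.inertia s)) t)

/-- The curve in the domain of `lagrangian` given by `κ`, `Ω`, `ξ`. -/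
def phase (κ Ω : ℝ → E) (ξ : ℝ → StrongDual ℝ E) (t : ℝ) :
    E × E × E × StrongDual ℝ E × StrongDual ℝ E × InertiaJet E :=
  (κ t, Ω t, deriv Ω t, ξ t, deriv ξ t, P.jet t)

/-- The variation of `phase`. -/
def phaseVariation (δκ δΩ : ℝ → E) (δξ : ℝ → StrongDual ℝ E) (t : ℝ) :
    E × E × E × StrongDual ℝ E × StrongDual ℝ E × InertiaJet E :=
  (δκ t, δΩ t, deriv δΩ t, δξ t, deriv δξ t, 0)

/-- The arguments of `multiplierFun` along curves. -/
def multiplierPhase (Ω : ℝ → E) (ξ : ℝ → StrongDual ℝ E) (t : ℝ) :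
    E × StrongDual ℝ E × StrongDual ℝ E × InertiaJet E :=
  (Ω t, ξ t, deriv ξ t, P.jet t)

variable {P} {κ Ω δκ δΩ : ℝ → E} {ξ δξ : ℝ → StrongDual ℝ E}

section Differentiable

variable (hI : ContDiff ℝ 1 (fun t => (P.inertia t : E →L[ℝ] StrongDual ℝ E)))

include hI

theorem multiplier_eq_multiplierFun (w : E) (η u : StrongDual ℝ E) (t : ℝ) :
    P.multiplier I G w η u t = P.multiplierFun I G (w, η, u, P.jet t) := by
  have h2 := ((contDiff_invAdjoint hI).differentiable (by simp) t).hasDerivAt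
  have h3 : HasDerivAt (fun s => invAdjoint (P.inertia s) η)
      (deriv (fun s => invAdjoint (P.inertia s)) t η) t := by
    have h := HasDerivAt.clm_apply (c := fun s => invAdjoint (P.inertia s))
      (u := fun _ => η) h2 (hasDerivAt_const t η)
    rwa [map_zero, add_zero] at h
  rw [multiplier, multiplierFun, h3.deriv]
  rfl

theorem deriv_inertia_apply {t : ℝ} (hΩ : DifferentiableAt ℝ Ω t) :
    deriv (fun s => P.inertia s (Ω s)) t
      = deriv (fun s => (P.inertia s : E →L[ℝ] StrongDual ℝ E)) t (Ω t)
        + P.inertia t (deriv Ω t) :=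
  (HasDerivAt.clm_apply (c := fun s => (P.inertia s : E →L[ℝ] StrongDual ℝ E)) (u := Ω)
    (hI.differentiable (by simp) t).hasDerivAt hΩ.hasDerivAt).deriv

theorem lagrangian_phase {t : ℝ} (hΩ : DifferentiableAt ℝ Ω t) :
    P.lagrangian I G (P.phase κ Ω ξ t)
      = P.C (Ω t, deriv Ω t, ξ t, deriv ξ t, t) + P.residual I G Ω ξ t (κ t) := by
  rw [residual, deriv_inertia_apply hI hΩ, multiplier_eq_multiplierFun I G hI]
  rfl

theorem continuous_jet : Continuous P.jet := by
  have h3 := hI.continuous_deriv le_rfl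
  have h4 := (contDiff_invAdjoint hI).continuous_deriv le_rfl
  have h5 := (contDiff_invAdjoint hI).continuous
  have h6 := hI.continuous
  unfold jet
  fun_prop

theorem continuous_phase (hκ : Continuous κ) (hΩ : ContDiff ℝ 1 Ω) (hξ : ContDiff ℝ 1 ξ) :
    Continuous (P.phase κ Ω ξ) :=
  hκ.prodMk (hΩ.continuous.prodMk ((hΩ.continuous_deriv le_rfl).prodMk
    (hξ.continuous.prodMk ((hξ.continuous_deriv le_rfl).prodMk (continuous_jet hI)))))

theorem continuous_multiplierPhase (hΩ : ContDiff ℝ 1 Ω) (hξ : ContDiff ℝ 1 ξ) :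
    Continuous (P.multiplierPhase Ω ξ) :=
  hΩ.continuous.prodMk
    (hξ.continuous.prodMk ((hξ.continuous_deriv le_rfl).prodMk (continuous_jet hI)))

end Differentiable

theorem continuous_phaseVariation (hκ : Continuous δκ) (hΩ : ContDiff ℝ 1 δΩ)
    (hξ : ContDiff ℝ 1 δξ) : Continuous (phaseVariation δκ δΩ δξ) := by
  have h1 := hΩ.continuous_deriv le_rfl
  have h2 := hξ.continuous_deriv le_rfl
  have h7 := hΩ.continuous
  have h8 := hξ.continuous
  unfold phaseVariation
  fun_prop

theorem phase_add_smul {t : ℝ} (hΩ : DifferentiableAt ℝ Ω t) (hξ : DifferentiableAt ℝ ξ t)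
    (hδΩ : DifferentiableAt ℝ δΩ t) (hδξ : DifferentiableAt ℝ δξ t) (ε : ℝ) :
    P.phase (κ + ε • δκ) (Ω + ε • δΩ) (ξ + ε • δξ) t
      = P.phase κ Ω ξ t + ε • phaseVariation δκ δΩ δξ t := by
  have h1 : deriv (Ω + ε • δΩ) t = deriv Ω t + ε • deriv δΩ t :=
    (hΩ.hasDerivAt.add (hδΩ.hasDerivAt.const_smul ε)).deriv
  have h2 : deriv (ξ + ε • δξ) t = deriv ξ t + ε • deriv δξ t :=
    (hξ.hasDerivAt.add (hδξ.hasDerivAt.const_smul ε)).deriv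
  simp only [phase, phaseVariation, h1, h2, Pi.add_apply, Pi.smul_apply, Prod.smul_mk,
    Prod.mk_add_mk, smul_zero, add_zero]

theorem contDiffAt_multiplierFun_phase {t : ℝ} (hγ : ContDiffAt ℝ 2 P.γ (ξ t, t))
    (hden : ξ t (invAdjoint (P.inertia t) (ξ t)) ≠ 0) :
    ContDiffAt ℝ 1 (P.multiplierFun I G) (P.multiplierPhase Ω ξ t) :=
  P.contDiffAt_multiplierFun I G (x := P.multiplierPhase Ω ξ t) hγ hden

theorem contDiffAt_lagrangian {t : ℝ} (hγ : ContDiffAt ℝ 2 P.γ (ξ t, t))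
    (hC : ContDiffAt ℝ 2 P.C (Ω t, deriv Ω t, ξ t, deriv ξ t, t))
    (hden : ξ t (invAdjoint (P.inertia t) (ξ t)) ≠ 0) :
    ContDiffAt ℝ 1 (P.lagrangian I G) (P.phase κ Ω ξ t) := by
  have hM := contDiffAt_multiplierFun_phase I G (Ω := Ω) hγ hden
  have h1 : ContDiffAt ℝ 1 (fun x : E × E × E × StrongDual ℝ E × StrongDual ℝ E × InertiaJet E =>
      P.C (x.2.1, x.2.2.1, x.2.2.2.1, x.2.2.2.2.1, x.2.2.2.2.2.toProd.1)) (P.phase κ Ω ξ t) :=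
    ContDiffAt.comp (g := P.C) (P.phase κ Ω ξ t) (hC.of_le (by norm_num)) (by fun_prop)
  have h2 : ContDiffAt ℝ 1 (fun x : E × E × E × StrongDual ℝ E × StrongDual ℝ E × InertiaJet E =>
      P.multiplierFun I G (x.2.1, x.2.2.2.1, x.2.2.2.2.1, x.2.2.2.2.2)) (P.phase κ Ω ξ t) :=
    ContDiffAt.comp (g := P.multiplierFun I G) (P.phase κ Ω ξ t) hM (by fun_prop)
  refine ContDiffAt.add h1 (ContDiffAt.sub ?_ (ContDiffAt.mul h2 ?_))
  · fun_prop
  · fun_prop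

/-! Partial derivatives in terms of total derivatives. -/

section Partial

variable {t : ℝ}

theorem costΩ_eq (hC : DifferentiableAt ℝ P.C (Ω t, deriv Ω t, ξ t, deriv ξ t, t)) :
    P.costΩ Ω ξ t = (fderiv ℝ P.C (Ω t, deriv Ω t, ξ t, deriv ξ t, t)).comp
      ((ContinuousLinearMap.id ℝ E).prod 0) :=
  (hC.hasFDerivAt.comp (f := fun x => (x, deriv Ω t, ξ t, deriv ξ t, t)) (Ω t)
    ((hasFDerivAt_id _).prodMk (hasFDerivAt_const _ _))).fderiv

theorem costΩdot_eq (hC : DifferentiableAt ℝ P.C (Ω t, deriv Ω t, ξ t, deriv ξ t, t)) :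
    P.costΩdot Ω ξ t = (fderiv ℝ P.C (Ω t, deriv Ω t, ξ t, deriv ξ t, t)).comp
      (ContinuousLinearMap.prod 0 ((ContinuousLinearMap.id ℝ E).prod 0)) :=
  (hC.hasFDerivAt.comp (f := fun x => (Ω t, x, ξ t, deriv ξ t, t)) (deriv Ω t)
    ((hasFDerivAt_const _ _).prodMk ((hasFDerivAt_id _).prodMk (hasFDerivAt_const _ _)))).fderiv

theorem costξ_eq (hC : DifferentiableAt ℝ P.C (Ω t, deriv Ω t, ξ t, deriv ξ t, t)) :
    P.costξ Ω ξ t = (fderiv ℝ P.C (Ω t, deriv Ω t, ξ t, deriv ξ t, t)).comp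
      (ContinuousLinearMap.prod 0 (ContinuousLinearMap.prod 0
        ((ContinuousLinearMap.id ℝ (StrongDual ℝ E)).prod 0))) :=
  (hC.hasFDerivAt.comp (f := fun x => (Ω t, deriv Ω t, x, deriv ξ t, t)) (ξ t)
    ((hasFDerivAt_const _ _).prodMk ((hasFDerivAt_const _ _).prodMk
      ((hasFDerivAt_id _).prodMk (hasFDerivAt_const _ _))))).fderiv

theorem costξdot_eq (hC : DifferentiableAt ℝ P.C (Ω t, deriv Ω t, ξ t, deriv ξ t, t)) :
    P.costξdot Ω ξ t = (fderiv ℝ P.C (Ω t, deriv Ω t, ξ t, deriv ξ t, t)).comp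
      (ContinuousLinearMap.prod 0 (ContinuousLinearMap.prod 0 (ContinuousLinearMap.prod 0
        ((ContinuousLinearMap.id ℝ (StrongDual ℝ E)).prod 0)))) :=
  (hC.hasFDerivAt.comp (f := fun x => (Ω t, deriv Ω t, ξ t, x, t)) (deriv ξ t)
    ((hasFDerivAt_const _ _).prodMk ((hasFDerivAt_const _ _).prodMk
      ((hasFDerivAt_const _ _).prodMk ((hasFDerivAt_id _).prodMk
        (hasFDerivAt_const _ _)))))).fderiv

theorem fderiv_cost_apply (hC : DifferentiableAt ℝ P.C (Ω t, deriv Ω t, ξ t, deriv ξ t, t))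
    (w v : E) (η u : StrongDual ℝ E) :
    fderiv ℝ P.C (Ω t, deriv Ω t, ξ t, deriv ξ t, t) (w, v, η, u, 0)
      = P.costΩ Ω ξ t w + P.costΩdot Ω ξ t v + P.costξ Ω ξ t η + P.costξdot Ω ξ t u := by
  rw [costΩ_eq hC, costΩdot_eq hC, costξ_eq hC, costξdot_eq hC]
  simp only [ContinuousLinearMap.comp_apply, ← map_add]
  simp

variable (hI : ContDiff ℝ 1 (fun t => (P.inertia t : E →L[ℝ] StrongDual ℝ E)))

include hI

theorem multiplierΩ_eq
    (hM : DifferentiableAt ℝ (P.multiplierFun I G) (P.multiplierPhase Ω ξ t)) :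
    P.multiplierΩ I G Ω ξ t = (fderiv ℝ (P.multiplierFun I G) (P.multiplierPhase Ω ξ t)).comp
      ((ContinuousLinearMap.id ℝ E).prod 0) := by
  rw [multiplierΩ]
  simp only [multiplier_eq_multiplierFun I G hI]
  exact (hM.hasFDerivAt.comp (f := fun x => (x, ξ t, deriv ξ t, _)) (Ω t)
    ((hasFDerivAt_id _).prodMk (hasFDerivAt_const _ _))).fderiv

theorem multiplierξ_eq
    (hM : DifferentiableAt ℝ (P.multiplierFun I G) (P.multiplierPhase Ω ξ t)) :
    P.multiplierξ I G Ω ξ t = (fderiv ℝ (P.multiplierFun I G) (P.multiplierPhase Ω ξ t)).comp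
      (ContinuousLinearMap.prod 0 ((ContinuousLinearMap.id ℝ (StrongDual ℝ E)).prod 0)) := by
  rw [multiplierξ]
  simp only [multiplier_eq_multiplierFun I G hI]
  exact (hM.hasFDerivAt.comp (f := fun x => (Ω t, x, deriv ξ t, _)) (ξ t)
    ((hasFDerivAt_const _ _).prodMk ((hasFDerivAt_id _).prodMk (hasFDerivAt_const _ _)))).fderiv

theorem multiplierξdot_eq
    (hM : DifferentiableAt ℝ (P.multiplierFun I G) (P.multiplierPhase Ω ξ t)) :
    P.multiplierξdot I G Ω ξ t = (fderiv ℝ (P.multiplierFun I G) (P.multiplierPhase Ω ξ t)).comp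
      (ContinuousLinearMap.prod 0 (ContinuousLinearMap.prod 0
        ((ContinuousLinearMap.id ℝ (StrongDual ℝ E)).prod 0))) := by
  rw [multiplierξdot]
  simp only [multiplier_eq_multiplierFun I G hI]
  exact (hM.hasFDerivAt.comp (f := fun x => (Ω t, ξ t, x, _)) (deriv ξ t)
    ((hasFDerivAt_const _ _).prodMk ((hasFDerivAt_const _ _).prodMk
      ((hasFDerivAt_id _).prodMk (hasFDerivAt_const _ _))))).fderiv

theorem fderiv_multiplierFun_apply
    (hM : DifferentiableAt ℝ (P.multiplierFun I G) (P.multiplierPhase Ω ξ t))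
    (w : E) (η u : StrongDual ℝ E) :
    fderiv ℝ (P.multiplierFun I G) (P.multiplierPhase Ω ξ t) (w, η, u, 0)
      = P.multiplierΩ I G Ω ξ t w + P.multiplierξ I G Ω ξ t η
        + P.multiplierξdot I G Ω ξ t u := by
  rw [multiplierΩ_eq I G hI hM, multiplierξ_eq I G hI hM, multiplierξdot_eq I G hI hM]
  simp only [ContinuousLinearMap.comp_apply, ← map_add]
  simp

omit hI in
theorem multiplierξdot_explicit :
    P.multiplierξdot I G Ω ξ t = (ξ t (invAdjoint (P.inertia t) (ξ t)))⁻¹ •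
      ((fderiv ℝ P.γ (ξ t, t)).comp (ContinuousLinearMap.inl ℝ (StrongDual ℝ E) ℝ)
        - (P.inertia t (Ω t)).comp (invAdjoint (P.inertia t))) := by
  have h1 : HasFDerivAt (fun u : StrongDual ℝ E => fderiv ℝ P.γ (ξ t, t) (u, 1))
      ((fderiv ℝ P.γ (ξ t, t)).comp (ContinuousLinearMap.inl ℝ (StrongDual ℝ E) ℝ))
      (deriv ξ t) :=
    (fderiv ℝ P.γ (ξ t, t)).hasFDerivAt.comp _ (hasFDerivAt_prodMk_left _ _)
  have h2 : HasFDerivAt (fun u : StrongDual ℝ E => P.inertia t (Ω t)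
        ((deriv (fun s => invAdjoint (P.inertia s) (ξ t)) t + invAdjoint (P.inertia t) u)
          + ad I G (Ω t) (invAdjoint (P.inertia t) (ξ t))))
      ((P.inertia t (Ω t)).comp (invAdjoint (P.inertia t))) (deriv ξ t) :=
    (P.inertia t (Ω t)).hasFDerivAt.comp _
      (((invAdjoint (P.inertia t)).hasFDerivAt.const_add _).add_const _)
  have h3 := (h1.sub h2).const_mul (ξ t (invAdjoint (P.inertia t) (ξ t)))⁻¹
  rw [multiplierξdot]
  simp only [multiplier, div_eq_inv_mul]
  exact h3.fderiv

end Partial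

end ControlProblem

namespace ControlProblem

variable {E : Type*} [NormedAddCommGroup E] [NormedSpace ℝ E] [FiniteDimensional ℝ E]
  {H : Type*} [TopologicalSpace H] (I : ModelWithCorners ℝ E H)
  (G : Type*) [TopologicalSpace G] [ChartedSpace H G] [Group G]
  [LieGroup I (minSmoothness ℝ 3) G] (P : ControlProblem E)

/-- The derivative of the integrand with respect to `Ω`, without the contribution of `δΩ̇`. -/
def forceΩ (κ Ω : ℝ → E) (ξ : ℝ → StrongDual ℝ E) (t : ℝ) : StrongDual ℝ E :=
  P.costΩ Ω ξ t
    + (deriv (fun s => (P.inertia s : E →L[ℝ] StrongDual ℝ E)) t).flip (κ t)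
    - adjoint (P.inertia t) (ad I G (Ω t) (κ t)) + adStar I G (κ t) (P.inertia t (Ω t))
    - ξ t (κ t) • P.multiplierΩ I G Ω ξ t

/-- The derivative of the integrand with respect to `Ω̇`. -/
def momentumΩ (κ Ω : ℝ → E) (ξ : ℝ → StrongDual ℝ E) (t : ℝ) : StrongDual ℝ E :=
  P.costΩdot Ω ξ t + adjoint (P.inertia t) (κ t)

/-- The derivative of the integrand with respect to `ξ`. -/
def forceξ (κ Ω : ℝ → E) (ξ : ℝ → StrongDual ℝ E) (t : ℝ) : StrongDual ℝ (StrongDual ℝ E) :=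
  P.costξ Ω ξ t - ξ t (κ t) • P.multiplierξ I G Ω ξ t
    - P.multiplier I G (Ω t) (ξ t) (deriv ξ t) t • NormedSpace.inclusionInDoubleDual ℝ E (κ t)

variable {P} {κ Ω δκ δΩ : ℝ → E} {ξ δξ : ℝ → StrongDual ℝ E}

theorem contDiffAt_sub_smul {F : Type*} [NormedAddCommGroup F] [NormedSpace ℝ F]
    {f g : ℝ → F} {c : ℝ → ℝ} {t : ℝ} (hf : ContDiffAt ℝ 1 f t) (hg : ContDiffAt ℝ 1 g t)
    (hc : ContDiffAt ℝ 1 c t) : ContDiffAt ℝ 1 (fun t => f t - c t • g t) t :=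
  hf.sub (hc.smul hg)

theorem hasDerivAt_clm_apply_line (A : E →L[ℝ] StrongDual ℝ E) (w k w' k' : E) :
    HasDerivAt (fun s : ℝ => A (w + s • w') (k + s • k')) (A w' k + A w k') 0 := by
  have hw : HasDerivAt (fun s : ℝ => w + s • w') w' 0 := by
    simpa using ((hasDerivAt_id (0 : ℝ)).smul_const w').const_add w
  have hk : HasDerivAt (fun s : ℝ => k + s • k') k' 0 := by
    simpa using ((hasDerivAt_id (0 : ℝ)).smul_const k').const_add k
  have h := HasDerivAt.clm_apply (c := fun s : ℝ => A (w + s • w'))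
    (A.hasFDerivAt.comp_hasDerivAt (f := fun s : ℝ => w + s • w') 0 hw) hk
  simpa using h

theorem fderiv_lagrangian_phase {t : ℝ}
    (hI : ContDiff ℝ 1 (fun t => (P.inertia t : E →L[ℝ] StrongDual ℝ E)))
    (hΩ : DifferentiableAt ℝ Ω t) (hγ : ContDiffAt ℝ 2 P.γ (ξ t, t))
    (hC : ContDiffAt ℝ 2 P.C (Ω t, deriv Ω t, ξ t, deriv ξ t, t))
    (hden : ξ t (invAdjoint (P.inertia t) (ξ t)) ≠ 0) :
    fderiv ℝ (P.lagrangian I G) (P.phase κ Ω ξ t) (phaseVariation δκ δΩ δξ t)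
      = P.residual I G Ω ξ t (δκ t)
        + (P.forceΩ I G κ Ω ξ t (δΩ t) + P.momentumΩ κ Ω ξ t (deriv δΩ t))
        + (P.forceξ I G κ Ω ξ t (δξ t) + P.controlMomentum I G κ Ω ξ t (deriv δξ t)) := by
  have hL := (contDiffAt_lagrangian I G (κ := κ) hγ hC hden).differentiableAt (by simp)
  have hM := (contDiffAt_multiplierFun_phase I G (Ω := Ω) hγ hden).differentiableAt (by simp)
  have hC' := hC.differentiableAt (by simp)
  have h0 := hasDerivAt_comp_add_smul (L := P.lagrangian I G) (x := P.phase κ Ω ξ t)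
    (v := phaseVariation δκ δΩ δξ t) (ε := 0) (by simpa using hL)
  rw [zero_smul, add_zero] at h0
  have hcost := hasDerivAt_comp_add_smul (L := P.C) (x := (Ω t, deriv Ω t, ξ t, deriv ξ t, t))
    (v := (δΩ t, deriv δΩ t, δξ t, deriv δξ t, 0)) (ε := 0) (by simpa using hC')
  rw [zero_smul, add_zero, fderiv_cost_apply hC'] at hcost
  have hmul := hasDerivAt_comp_add_smul (L := P.multiplierFun I G)
    (x := P.multiplierPhase Ω ξ t)
    (v := (δΩ t, δξ t, deriv δξ t, 0)) (ε := 0) (by simpa using hM)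
  rw [zero_smul, add_zero, fderiv_multiplierFun_apply I G hI hM] at hmul
  have hk : HasDerivAt (fun s : ℝ => κ t + s • δκ t) (δκ t) 0 := by
    simpa using ((hasDerivAt_id (0 : ℝ)).smul_const (δκ t)).const_add (κ t)
  have hx : HasDerivAt (fun s : ℝ => ξ t + s • δξ t) (δξ t) 0 := by
    simpa using ((hasDerivAt_id (0 : ℝ)).smul_const (δξ t)).const_add (ξ t)
  have hw : HasDerivAt (fun s : ℝ => Ω t + s • δΩ t) (δΩ t) 0 := by
    simpa using ((hasDerivAt_id (0 : ℝ)).smul_const (δΩ t)).const_add (Ω t)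
  have h1 := hasDerivAt_clm_apply_line
    (deriv (fun s => (P.inertia s : E →L[ℝ] StrongDual ℝ E)) t) (Ω t) (κ t) (δΩ t) (δκ t)
  have h2 := hasDerivAt_clm_apply_line
    (P.inertia t : E →L[ℝ] StrongDual ℝ E) (deriv Ω t) (κ t) (deriv δΩ t) (δκ t)
  have h3 : HasDerivAt (fun s : ℝ => adL I G (Ω t + s • δΩ t) (κ t + s • δκ t))
      (adL I G (δΩ t) (κ t) + adL I G (Ω t) (δκ t)) 0 := by
    have h := HasDerivAt.clm_apply (c := fun s : ℝ => adL I G (Ω t + s • δΩ t))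
      ((adL I G).hasFDerivAt.comp_hasDerivAt (f := fun s : ℝ => Ω t + s • δΩ t) 0 hw) hk
    simpa using h
  have h4 : HasDerivAt (fun s : ℝ => P.inertia t (Ω t + s • δΩ t)
        (adL I G (Ω t + s • δΩ t) (κ t + s • δκ t)))
      (P.inertia t (δΩ t) (adL I G (Ω t) (κ t))
        + P.inertia t (Ω t) (adL I G (δΩ t) (κ t) + adL I G (Ω t) (δκ t))) 0 := by
    have h := HasDerivAt.clm_apply (c := fun s : ℝ => P.inertia t (Ω t + s • δΩ t))
      ((P.inertia t : E →L[ℝ] StrongDual ℝ E).hasFDerivAt.comp_hasDerivAt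
        (f := fun s : ℝ => Ω t + s • δΩ t) 0 hw) h3
    simpa using h
  have h5 : HasDerivAt (fun s : ℝ => (ξ t + s • δξ t) (κ t + s • δκ t))
      (δξ t (κ t) + ξ t (δκ t)) 0 := by
    simpa using hx.clm_apply hk
  have hsum := hcost.add (((h1.add h2).sub h4).sub (hmul.mul h5))
  have hfun : (fun s : ℝ => P.lagrangian I G (P.phase κ Ω ξ t + s • phaseVariation δκ δΩ δξ t))
      = fun s : ℝ => P.C ((Ω t, deriv Ω t, ξ t, deriv ξ t, t)
          + s • (δΩ t, deriv δΩ t, δξ t, deriv δξ t, 0))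
        + (deriv (fun s => (P.inertia s : E →L[ℝ] StrongDual ℝ E)) t (Ω t + s • δΩ t)
            (κ t + s • δκ t)
          + P.inertia t (deriv Ω t + s • deriv δΩ t) (κ t + s • δκ t)
          - P.inertia t (Ω t + s • δΩ t) (adL I G (Ω t + s • δΩ t) (κ t + s • δκ t))
          - P.multiplierFun I G (P.multiplierPhase Ω ξ t + s • (δΩ t, δξ t, deriv δξ t, 0))
            * (ξ t + s • δξ t) (κ t + s • δκ t)) := by
    funext s
    simp only [phase, phaseVariation, multiplierPhase, smul_zero, Prod.smul_mk, Prod.mk_add_mk,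
      add_zero]
    rfl
  rw [hfun] at h0
  rw [h0.unique hsum, residual, deriv_inertia_apply hI hΩ, forceΩ, momentumΩ, forceξ,
    controlMomentum, multiplier_eq_multiplierFun I G hI]
  have hskew : adL I G (δΩ t) (κ t) = -ad I G (κ t) (δΩ t) := ad_skew I G _ _
  simp only [hskew]
  simp [adStar, adjoint, adL_apply, multiplierPhase]
  ring

section Regularity

variable {s : Set ℝ}
  (hI : ContDiff ℝ 1 (fun t => (P.inertia t : E →L[ℝ] StrongDual ℝ E)))
  (hΩ : ContDiff ℝ 2 Ω) (hξ : ContDiff ℝ 2 ξ)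
  (hγ : ∀ t ∈ s, ContDiffAt ℝ 2 P.γ (ξ t, t))
  (hC : ∀ t ∈ s, ContDiffAt ℝ 2 P.C (Ω t, deriv Ω t, ξ t, deriv ξ t, t))
  (hden : ∀ t ∈ s, ξ t (invAdjoint (P.inertia t) (ξ t)) ≠ 0)

include hΩ hξ

theorem contDiff_costPhase : ContDiff ℝ 1 (fun t => (Ω t, deriv Ω t, ξ t, deriv ξ t, t)) := by
  have h1 : ContDiff ℝ 1 (deriv Ω) := hΩ.deriv'
  have h2 : ContDiff ℝ 1 (deriv ξ) := hξ.deriv'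
  have h3 : ContDiff ℝ 1 Ω := hΩ.of_le (by norm_num)
  have h4 : ContDiff ℝ 1 ξ := hξ.of_le (by norm_num)
  fun_prop

theorem contDiffAt_fderiv_cost {t : ℝ}
    (hC : ContDiffAt ℝ 2 P.C (Ω t, deriv Ω t, ξ t, deriv ξ t, t)) :
    ContDiffAt ℝ 1 (fun t => fderiv ℝ P.C (Ω t, deriv Ω t, ξ t, deriv ξ t, t)) t :=
  ContDiffAt.comp t (g := fderiv ℝ P.C) (hC.fderiv_right (by norm_num))
    (contDiff_costPhase hΩ hξ).contDiffAt

theorem eventually_differentiableAt_cost {t : ℝ}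
    (hC : ContDiffAt ℝ 2 P.C (Ω t, deriv Ω t, ξ t, deriv ξ t, t)) :
    ∀ᶠ r in 𝓝 t, DifferentiableAt ℝ P.C (Ω r, deriv Ω r, ξ r, deriv ξ r, r) :=
  ((contDiff_costPhase hΩ hξ).continuous.continuousAt.eventually
    (hC.eventually (by simp))).mono fun _ h => h.differentiableAt (by simp)

theorem contDiffAt_costΩdot {t : ℝ}
    (hC : ContDiffAt ℝ 2 P.C (Ω t, deriv Ω t, ξ t, deriv ξ t, t)) :
    ContDiffAt ℝ 1 (P.costΩdot Ω ξ) t :=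
  ((contDiffAt_fderiv_cost hΩ hξ hC).clm_comp contDiffAt_const).congr_of_eventuallyEq
    ((eventually_differentiableAt_cost hΩ hξ hC).mono fun _ h => costΩdot_eq h)

theorem contDiffAt_costξdot {t : ℝ}
    (hC : ContDiffAt ℝ 2 P.C (Ω t, deriv Ω t, ξ t, deriv ξ t, t)) :
    ContDiffAt ℝ 1 (P.costξdot Ω ξ) t :=
  ((contDiffAt_fderiv_cost hΩ hξ hC).clm_comp contDiffAt_const).congr_of_eventuallyEq
    ((eventually_differentiableAt_cost hΩ hξ hC).mono fun _ h => costξdot_eq h)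

include hC in
theorem continuousOn_fderiv_cost :
    ContinuousOn (fun t => fderiv ℝ P.C (Ω t, deriv Ω t, ξ t, deriv ξ t, t)) s := fun t ht =>
  (contDiffAt_fderiv_cost hΩ hξ (hC t ht)).continuousAt.continuousWithinAt

include hC in
theorem continuousOn_costΩ : ContinuousOn (P.costΩ Ω ξ) s :=
  ((continuousOn_fderiv_cost hΩ hξ hC).clm_comp continuousOn_const).congr
    fun t ht => costΩ_eq ((hC t ht).differentiableAt (by simp))

include hC in
theorem continuousOn_costξ : ContinuousOn (P.costξ Ω ξ) s :=
  ((continuousOn_fderiv_cost hΩ hξ hC).clm_comp continuousOn_const).congr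
    fun t ht => costξ_eq ((hC t ht).differentiableAt (by simp))

include hI hγ hden

theorem continuousOn_multiplierFun_phase :
    ContinuousOn (fun t => P.multiplierFun I G (P.multiplierPhase Ω ξ t)) s := fun t ht =>
  ((contDiffAt_multiplierFun_phase I G (hγ t ht) (hden t ht)).continuousAt.comp
    (continuous_multiplierPhase hI (hΩ.of_le (by norm_num))
      (hξ.of_le (by norm_num))).continuousAt).continuousWithinAt

theorem continuousOn_fderiv_multiplierFun :
    ContinuousOn (fun t => fderiv ℝ (P.multiplierFun I G) (P.multiplierPhase Ω ξ t)) s :=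
  fun t ht => (ContinuousAt.comp (g := fderiv ℝ (P.multiplierFun I G))
    ((contDiffAt_multiplierFun_phase I G (hγ t ht) (hden t ht)).continuousAt_fderiv (by simp))
    (continuous_multiplierPhase hI (hΩ.of_le (by norm_num))
      (hξ.of_le (by norm_num))).continuousAt).continuousWithinAt

theorem continuousOn_multiplier :
    ContinuousOn (fun t => P.multiplier I G (Ω t) (ξ t) (deriv ξ t) t) s :=
  (continuousOn_multiplierFun_phase I G hI hΩ hξ hγ hden).congr fun t _ =>
    multiplier_eq_multiplierFun I G hI _ _ _ t

theorem continuousOn_multiplierΩ : ContinuousOn (P.multiplierΩ I G Ω ξ) s :=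
  ((continuousOn_fderiv_multiplierFun I G hI hΩ hξ hγ hden).clm_comp continuousOn_const).congr
    fun t ht => multiplierΩ_eq I G hI
      ((contDiffAt_multiplierFun_phase I G (hγ t ht) (hden t ht)).differentiableAt (by simp))

theorem continuousOn_multiplierξ : ContinuousOn (P.multiplierξ I G Ω ξ) s :=
  ((continuousOn_fderiv_multiplierFun I G hI hΩ hξ hγ hden).clm_comp continuousOn_const).congr
    fun t ht => multiplierξ_eq I G hI
      ((contDiffAt_multiplierFun_phase I G (hγ t ht) (hden t ht)).differentiableAt (by simp))

omit hγ hden in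
theorem contDiffAt_multiplierξdot {t : ℝ} (hγ : ContDiffAt ℝ 2 P.γ (ξ t, t))
    (hden : ξ t (invAdjoint (P.inertia t) (ξ t)) ≠ 0) :
    ContDiffAt ℝ 1 (P.multiplierξdot I G Ω ξ) t := by
  have hΩ1 : ContDiffAt ℝ 1 Ω t := (hΩ.of_le (by norm_num)).contDiffAt
  have hξ1 : ContDiffAt ℝ 1 ξ t := (hξ.of_le (by norm_num)).contDiffAt
  have hK := (contDiff_invAdjoint hI).contDiffAt (x := t)
  have h1 : ContDiffAt ℝ 1 (fun r => fderiv ℝ P.γ (ξ r, r)) t :=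
    ContDiffAt.comp t (g := fderiv ℝ P.γ) (f := fun r => (ξ r, r))
      (hγ.fderiv_right (by norm_num)) (hξ1.prodMk contDiffAt_id)
  have h2 : ContDiffAt ℝ 1 (fun r => P.inertia r (Ω r)) t :=
    ContDiffAt.clm_apply (f := fun r => (P.inertia r : E →L[ℝ] StrongDual ℝ E))
      hI.contDiffAt hΩ1
  have h3 : ContDiffAt ℝ 1 (fun r => (ξ r (invAdjoint (P.inertia r) (ξ r)))⁻¹) t :=
    (hξ1.clm_apply (hK.clm_apply hξ1)).inv hden
  exact (h3.smul ((h1.clm_comp contDiffAt_const).sub (h2.clm_comp hK))).congr_of_eventuallyEq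
    (Filter.Eventually.of_forall fun r => multiplierξdot_explicit I G)

omit hγ hden in
theorem contDiffAt_controlMomentum {t : ℝ} (hκ : ContDiff ℝ 1 κ)
    (hγ : ContDiffAt ℝ 2 P.γ (ξ t, t))
    (hC : ContDiffAt ℝ 2 P.C (Ω t, deriv Ω t, ξ t, deriv ξ t, t))
    (hden : ξ t (invAdjoint (P.inertia t) (ξ t)) ≠ 0) :
    ContDiffAt ℝ 1 (P.controlMomentum I G κ Ω ξ) t :=
  contDiffAt_sub_smul (contDiffAt_costξdot hΩ hξ hC)
    (contDiffAt_multiplierξdot I G hI hΩ hξ hγ hden)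
    ((hξ.of_le (by norm_num)).contDiffAt.clm_apply hκ.contDiffAt)

theorem continuousOn_residual : ContinuousOn (P.residual I G Ω ξ) s := by
  have hΩ1 : ContDiff ℝ 1 Ω := hΩ.of_le (by norm_num)
  have h2 : ContDiff ℝ 1 (fun r => P.inertia r (Ω r)) :=
    ContDiff.clm_apply (f := fun r => (P.inertia r : E →L[ℝ] StrongDual ℝ E)) hI hΩ1
  refine ((h2.continuous_deriv le_rfl).continuousOn.sub ?_).sub
    ((continuousOn_multiplier I G hI hΩ hξ hγ hden).smul hξ.continuous.continuousOn)
  exact (h2.continuous.clm_comp ((adL I G).continuous.comp hΩ.continuous)).continuousOn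

include hC

theorem continuousOn_forceΩ (hκ : Continuous κ) : ContinuousOn (P.forceΩ I G κ Ω ξ) s := by
  have hΩ1 : ContDiff ℝ 1 Ω := hΩ.of_le (by norm_num)
  have h2 : ContDiff ℝ 1 (fun r => P.inertia r (Ω r)) :=
    ContDiff.clm_apply (f := fun r => (P.inertia r : E →L[ℝ] StrongDual ℝ E)) hI hΩ1
  refine ((((continuousOn_costΩ hΩ hξ hC).add ?_).sub ?_).add ?_).sub
    ((hξ.continuous.clm_apply hκ).continuousOn.smul
      (continuousOn_multiplierΩ I G hI hΩ hξ hγ hden))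
  · exact ((contDiff_flip.continuous.comp (hI.continuous_deriv le_rfl)).clm_apply hκ).continuousOn
  · exact ((contDiff_adjoint hI).continuous.clm_apply
      (((adL I G).continuous.comp hΩ.continuous).clm_apply hκ)).continuousOn
  · exact (h2.continuous.clm_comp ((adL I G).continuous.comp hκ)).continuousOn

theorem continuousOn_forceξ (hκ : Continuous κ) : ContinuousOn (P.forceξ I G κ Ω ξ) s := by
  refine continuousOn_clm_apply.mpr fun η => ?_
  have h1 := (continuousOn_costξ hΩ hξ hC).clm_apply (continuousOn_const (c := η))
  have h2 := (continuousOn_multiplierξ I G hI hΩ hξ hγ hden).clm_apply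
    (continuousOn_const (c := η))
  have h3 : ContinuousOn (fun t => ξ t (κ t)) s := (hξ.continuous.clm_apply hκ).continuousOn
  have h4 : ContinuousOn (fun t => η (κ t)) s := (η.continuous.comp hκ).continuousOn
  exact (h1.sub (h3.mul h2)).sub ((continuousOn_multiplier I G hI hΩ hξ hγ hden).mul h4)

end Regularity

end ControlProblem

namespace ControlProblem

variable {E : Type*} [NormedAddCommGroup E] [NormedSpace ℝ E] [FiniteDimensional ℝ E]
  {H : Type*} [TopologicalSpace H] (I : ModelWithCorners ℝ E H)
  (G : Type*) [TopologicalSpace G] [ChartedSpace H G] [Group G]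
  [LieGroup I (minSmoothness ℝ 3) G] (P : ControlProblem E)

/-- The left-hand side of the costate equation. -/
def costateResidual (κ Ω : ℝ → E) (ξ : ℝ → StrongDual ℝ E) (t : ℝ) : StrongDual ℝ E :=
  P.costΩ Ω ξ t - deriv (P.costΩdot Ω ξ) t
      - adjoint (P.inertia t) (deriv κ t + ad I G (Ω t) (κ t))
      + adStar I G (κ t) (P.inertia t (Ω t)) - ξ t (κ t) • P.multiplierΩ I G Ω ξ t

/-- The left-hand side of the control equation. -/
def controlResidual (κ Ω : ℝ → E) (ξ : ℝ → StrongDual ℝ E) (t : ℝ) :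
    StrongDual ℝ (StrongDual ℝ E) :=
  -deriv (P.controlMomentum I G κ Ω ξ) t
      + (P.costξ Ω ξ t - ξ t (κ t) • P.multiplierξ I G Ω ξ t)
      - P.multiplier I G (Ω t) (ξ t) (deriv ξ t) t
        • NormedSpace.inclusionInDoubleDual ℝ E (κ t)

/-- The differential of the performance index, after integration by parts. -/
def firstVariation (κ Ω : ℝ → E) (ξ : ℝ → StrongDual ℝ E) (ρ ν : StrongDual ℝ E) (b : ℝ)
    (δκ δΩ : ℝ → E) (δξ : ℝ → StrongDual ℝ E) (dρ dν : StrongDual ℝ E) (db : ℝ) : ℝ :=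
  dρ (Ω P.a - P.Ωa) + ρ (δΩ P.a) + dν (Ω b - P.Ωb) + ν (δΩ b + db • deriv Ω b)
    + (P.momentumΩ κ Ω ξ b (δΩ b) - P.momentumΩ κ Ω ξ P.a (δΩ P.a))
    + (P.controlMomentum I G κ Ω ξ b (δξ b) - P.controlMomentum I G κ Ω ξ P.a (δξ P.a))
    + (∫ t in P.a..b, P.residual I G Ω ξ t (δκ t))
    + (∫ t in P.a..b, P.costateResidual I G κ Ω ξ t (δΩ t))
    + (∫ t in P.a..b, P.controlResidual I G κ Ω ξ t (δξ t))
    + db * (P.C (Ω b, deriv Ω b, ξ b, deriv ξ b, b) + P.residual I G Ω ξ b (κ b))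

variable {P} {κ Ω δκ δΩ : ℝ → E} {ξ δξ : ℝ → StrongDual ℝ E}

theorem hasDerivAt_boundary_term {ν dν : StrongDual ℝ E} {b db : ℝ} {q : E}
    (hΩ : ContDiff ℝ 1 Ω) (hδΩ : ContDiff ℝ 1 δΩ) :
    HasDerivAt (fun ε : ℝ => (ν + ε • dν) ((Ω + ε • δΩ) (b + ε * db) - q))
      (dν (Ω b - q) + ν (δΩ b + db • deriv Ω b)) 0 := by
  have hb : HasDerivAt (fun ε : ℝ => b + ε * db) db 0 := by
    simpa using ((hasDerivAt_id (0 : ℝ)).mul_const db).const_add b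
  have hν : HasDerivAt (fun ε : ℝ => ν + ε • dν) dν 0 := by
    simpa using ((hasDerivAt_id (0 : ℝ)).smul_const dν).const_add ν
  have h1 : HasDerivAt (fun ε : ℝ => Ω (b + ε * db)) (db • deriv Ω b) 0 := by
    have h := (hΩ.differentiable (by simp) (b + 0 * db)).hasDerivAt
    have h' := HasDerivAt.scomp (h := fun ε : ℝ => b + ε * db) (0 : ℝ) h hb
    simpa [Function.comp_def] using h'
  have h2 : HasDerivAt (fun ε : ℝ => δΩ (b + ε * db)) (db • deriv δΩ b) 0 := by
    have h := (hδΩ.differentiable (by simp) (b + 0 * db)).hasDerivAt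
    have h' := HasDerivAt.scomp (h := fun ε : ℝ => b + ε * db) (0 : ℝ) h hb
    simpa [Function.comp_def] using h'
  have h3 := hν.clm_apply ((h1.add ((hasDerivAt_id (0 : ℝ)).smul h2)).sub_const q)
  refine HasDerivAt.congr_deriv (f := fun ε : ℝ =>
    (ν + ε • dν) ((Ω + ε • δΩ) (b + ε * db) - q)) h3 ?_
  simp [add_comm]

theorem momentumΩ_apply (t : ℝ) (v : E) :
    P.momentumΩ κ Ω ξ t v = P.costΩdot Ω ξ t v + P.inertia t v (κ t) := rfl

theorem transversality_iff {b : ℝ}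
    (hI : ContDiff ℝ 1 (fun t => (P.inertia t : E →L[ℝ] StrongDual ℝ E)))
    (hΩ : DifferentiableAt ℝ Ω b) (hb : P.residual I G Ω ξ b = 0) :
    P.Transversality I G κ Ω ξ b ↔
      P.C (Ω b, deriv Ω b, ξ b, deriv ξ b, b) = P.momentumΩ κ Ω ξ b (deriv Ω b) := by
  have h := congrArg (fun f : StrongDual ℝ E => f (κ b)) hb
  rw [residual, deriv_inertia_apply hI hΩ] at h
  simp only [sub_apply, add_apply, zero_apply] at h
  rw [Transversality, momentumΩ_apply]
  simp only [add_apply, neg_apply]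
  constructor <;> intro h' <;> linarith

section Stationarity

theorem controlResidual_apply (t : ℝ) (η : StrongDual ℝ E) : P.controlResidual I G κ Ω ξ t η
    = P.forceξ I G κ Ω ξ t η - deriv (P.controlMomentum I G κ Ω ξ) t η := by
  simp only [controlResidual, forceξ, sub_apply, add_apply, neg_apply]
  ring

variable {b : ℝ}
  (hI : ContDiff ℝ 1 (fun t => (P.inertia t : E →L[ℝ] StrongDual ℝ E)))
  (hκ : ContDiff ℝ 1 κ) (hΩ : ContDiff ℝ 2 Ω) (hξ : ContDiff ℝ 2 ξ)
  (hγ : ∀ t ∈ Set.Icc P.a b, ContDiffAt ℝ 2 P.γ (ξ t, t))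
  (hC : ∀ t ∈ Set.Icc P.a b, ContDiffAt ℝ 2 P.C (Ω t, deriv Ω t, ξ t, deriv ξ t, t))
  (hden : ∀ t ∈ Set.Icc P.a b, ξ t (invAdjoint (P.inertia t) (ξ t)) ≠ 0)

include hI hκ hΩ hξ hC

theorem contDiffAt_momentumΩ : ∀ t ∈ Set.Icc P.a b, ContDiffAt ℝ 1 (P.momentumΩ κ Ω ξ) t :=
  fun t ht => (contDiffAt_costΩdot hΩ hξ (hC t ht)).add
    ((contDiff_adjoint hI).contDiffAt.clm_apply hκ.contDiffAt)

theorem costateResidual_eq {t : ℝ} (ht : t ∈ Set.Icc P.a b) :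
    P.costateResidual I G κ Ω ξ t = P.forceΩ I G κ Ω ξ t - deriv (P.momentumΩ κ Ω ξ) t := by
  have h1 := ((contDiffAt_costΩdot hΩ hξ (hC t ht)).differentiableAt (by simp)).hasDerivAt
  have h3 : HasDerivAt (P.momentumΩ κ Ω ξ) _ t :=
    h1.add ((hasDerivAt_adjoint hI t).clm_apply (hκ.differentiable (by simp) t).hasDerivAt)
  rw [h3.deriv, forceΩ, costateResidual, map_add]
  abel

include hγ hden

theorem continuousOn_costateResidual :
    ContinuousOn (P.costateResidual I G κ Ω ξ) (Set.Icc P.a b) :=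
  ((continuousOn_forceΩ I G hI hΩ hξ hγ hC hden hκ.continuous).sub
    (continuousOn_deriv_of_contDiffAt
      (contDiffAt_momentumΩ hI hκ hΩ hξ hC))).congr fun _ ht =>
    costateResidual_eq I G hI hκ hΩ hξ hC ht

theorem contDiffAt_controlMomentum_Icc :
    ∀ t ∈ Set.Icc P.a b, ContDiffAt ℝ 1 (P.controlMomentum I G κ Ω ξ) t :=
  fun t ht => contDiffAt_controlMomentum I G hI hΩ hξ hκ (hγ t ht) (hC t ht) (hden t ht)

theorem continuousOn_controlResidual :
    ContinuousOn (P.controlResidual I G κ Ω ξ) (Set.Icc P.a b) := by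
  refine continuousOn_clm_apply.mpr fun η => ?_
  have h1 := (continuousOn_forceξ I G hI hΩ hξ hγ hC hden hκ.continuous).clm_apply
    (continuousOn_const (c := η))
  have h2 := (continuousOn_deriv_of_contDiffAt
    (contDiffAt_controlMomentum_Icc I G hI hκ hΩ hξ hγ hC hden)).clm_apply
      (continuousOn_const (c := η))
  exact (h1.sub h2).congr fun t _ => controlResidual_apply I G t η

variable (hab : P.a < b)

include hab

theorem integral_fderiv_lagrangian (hδκ : Continuous δκ) (hδΩ : ContDiff ℝ 1 δΩ)
    (hδξ : ContDiff ℝ 1 δξ) :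
    ∫ t in P.a..b,
        fderiv ℝ (P.lagrangian I G) (P.phase κ Ω ξ t) (phaseVariation δκ δΩ δξ t)
      = (∫ t in P.a..b, P.residual I G Ω ξ t (δκ t))
        + (P.momentumΩ κ Ω ξ b (δΩ b) - P.momentumΩ κ Ω ξ P.a (δΩ P.a)
          + ∫ t in P.a..b, P.costateResidual I G κ Ω ξ t (δΩ t))
        + (P.controlMomentum I G κ Ω ξ b (δξ b) - P.controlMomentum I G κ Ω ξ P.a (δξ P.a)
          + ∫ t in P.a..b, P.controlResidual I G κ Ω ξ t (δξ t)) := by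
  have hpΩ := contDiffAt_momentumΩ hI hκ hΩ hξ hC
  have hpξ := contDiffAt_controlMomentum_Icc I G hI hκ hΩ hξ hγ hC hden
  have hfΩ := continuousOn_forceΩ I G hI hΩ hξ hγ hC hden hκ.continuous
  have hfξ := continuousOn_forceξ I G hI hΩ hξ hγ hC hden hκ.continuous
  rw [← integral_force_add_momentum hab.le hfΩ hpΩ (fun t ht v => by
      rw [costateResidual_eq I G hI hκ hΩ hξ hC ht]; rfl) hδΩ,
    ← integral_force_add_momentum hab.le hfξ hpξ
      (fun t _ η => controlResidual_apply I G t η) hδξ]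
  have i1 : IntervalIntegrable (fun t => P.residual I G Ω ξ t (δκ t))
      MeasureTheory.volume P.a b :=
    ((continuousOn_residual I G hI hΩ hξ hγ hden).clm_apply
      hδκ.continuousOn).intervalIntegrable_of_Icc hab.le
  have i2 : IntervalIntegrable (fun t => P.forceΩ I G κ Ω ξ t (δΩ t)
      + P.momentumΩ κ Ω ξ t (deriv δΩ t)) MeasureTheory.volume P.a b :=
    ((hfΩ.clm_apply hδΩ.continuous.continuousOn).add
      (ContinuousOn.clm_apply (fun t ht => (hpΩ t ht).continuousAt.continuousWithinAt)
        (hδΩ.continuous_deriv le_rfl).continuousOn)).intervalIntegrable_of_Icc hab.le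
  have i3 : IntervalIntegrable (fun t => P.forceξ I G κ Ω ξ t (δξ t)
      + P.controlMomentum I G κ Ω ξ t (deriv δξ t)) MeasureTheory.volume P.a b :=
    ((hfξ.clm_apply hδξ.continuous.continuousOn).add
      (ContinuousOn.clm_apply (fun t ht => (hpξ t ht).continuousAt.continuousWithinAt)
        (hδξ.continuous_deriv le_rfl).continuousOn)).intervalIntegrable_of_Icc hab.le
  rw [← intervalIntegral.integral_add i1 i2, ← intervalIntegral.integral_add (i1.add i2) i3]
  refine intervalIntegral.integral_congr fun t ht => ?_
  rw [Set.uIcc_of_le hab.le] at ht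
  exact fderiv_lagrangian_phase I G hI (hΩ.differentiable (by simp) t) (hγ t ht) (hC t ht)
    (hden t ht)

theorem hasDerivAt_performanceIndex {ρ ν dρ dν : StrongDual ℝ E} {db : ℝ}
    (hδκ : Continuous δκ) (hδΩ : ContDiff ℝ 1 δΩ) (hδξ : ContDiff ℝ 1 δξ) :
    HasDerivAt (fun ε : ℝ => P.performanceIndex I G (κ + ε • δκ) (Ω + ε • δΩ) (ξ + ε • δξ)
      (ρ + ε • dρ) (ν + ε • dν) (b + ε * db))
      (P.firstVariation I G κ Ω ξ ρ ν b δκ δΩ δξ dρ dν db) 0 := by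
  have hΩ1 : ContDiff ℝ 1 Ω := hΩ.of_le (by norm_num)
  have hξ1 : ContDiff ℝ 1 ξ := hξ.of_le (by norm_num)
  have h1 := hasDerivAt_boundary_term (ν := ρ) (dν := dρ) (b := P.a) (db := 0)
    (q := P.Ωa) hΩ1 hδΩ
  have h2 := hasDerivAt_boundary_term (ν := ν) (dν := dν) (b := b) (db := db)
    (q := P.Ωb) hΩ1 hδΩ
  have h3 := hasDerivAt_action hab.le (continuous_phase hI hκ.continuous hΩ1 hξ1)
    (continuous_phaseVariation hδκ hδΩ hδξ) (L := P.lagrangian I G)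
    (fun t ht => contDiffAt_lagrangian I G (hγ t ht) (hC t ht) (hden t ht)) db
  rw [integral_fderiv_lagrangian I G hI hκ hΩ hξ hγ hC hden hab hδκ hδΩ hδξ,
    lagrangian_phase I G hI (hΩ1.differentiable (by simp) b)] at h3
  have hfun : (fun ε : ℝ => P.performanceIndex I G (κ + ε • δκ) (Ω + ε • δΩ) (ξ + ε • δξ)
      (ρ + ε • dρ) (ν + ε • dν) (b + ε * db))
      = fun ε : ℝ => (ρ + ε • dρ) ((Ω + ε • δΩ) (P.a + ε * 0) - P.Ωa)
        + (ν + ε • dν) ((Ω + ε • δΩ) (b + ε * db) - P.Ωb)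
        + ∫ t in P.a..(b + ε * db),
            P.lagrangian I G (P.phase κ Ω ξ t + ε • phaseVariation δκ δΩ δξ t) := by
    funext ε
    rw [performanceIndex, mul_zero, add_zero]
    congr 1
    refine intervalIntegral.integral_congr fun t _ => ?_
    have hd : DifferentiableAt ℝ (Ω + ε • δΩ) t :=
      (hΩ1.differentiable (by simp) t).add ((hδΩ.differentiable (by simp) t).const_smul ε)
    rw [← phase_add_smul (hΩ1.differentiable (by simp) t) (hξ1.differentiable (by simp) t)
      (hδΩ.differentiable (by simp) t) (hδξ.differentiable (by simp) t),
      lagrangian_phase I G hI hd]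
  rw [hfun]
  refine ((h1.add h2).add h3).congr_deriv ?_
  rw [firstVariation, zero_smul, add_zero]
  ring

theorem differentialVanishes_iff {ρ ν dρ dν : StrongDual ℝ E} {db : ℝ}
    (hδκ : ContDiff ℝ ∞ δκ) (hδΩ : ContDiff ℝ ∞ δΩ) (hδξ : ContDiff ℝ ∞ δξ) :
    P.DifferentialVanishes I G κ Ω ξ ρ ν b δκ δΩ δξ dρ dν db ↔
      P.firstVariation I G κ Ω ξ ρ ν b δκ δΩ δξ dρ dν db = 0 := by
  have h := hasDerivAt_performanceIndex I G hI hκ hΩ hξ hγ hC hden hab (ρ := ρ) (ν := ν)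
    (dρ := dρ) (dν := dν) (db := db) hδκ.continuous (hδΩ.of_le (by simp)) (hδξ.of_le (by simp))
  refine ⟨fun h' => h.unique h', fun h' => ?_⟩
  rw [h'] at h
  exact h

theorem isOptimallyControlled_of_isStationary {ρ ν : StrongDual ℝ E}
    (h : P.IsStationaryFixedTime I G κ Ω ξ ρ ν b) : P.IsOptimallyControlled I G κ Ω ξ b := by
  have h0 : ∀ (δκ δΩ : ℝ → E) (δξ : ℝ → StrongDual ℝ E) (dρ dν : StrongDual ℝ E),
      ContDiff ℝ ∞ δκ → ContDiff ℝ ∞ δΩ → ContDiff ℝ ∞ δξ → δΩ P.a = 0 →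
        P.firstVariation I G κ Ω ξ ρ ν b δκ δΩ δξ dρ dν 0 = 0 :=
    fun δκ δΩ δξ dρ dν h1 h2 h3 h4 =>
      (differentialVanishes_iff I G hI hκ hΩ hξ hγ hC hden hab h1 h2 h3).mp
        (h δκ δΩ δξ dρ dν h1 h2 h3 h4)
  have zE : ContDiff ℝ ∞ (fun _ : ℝ => (0 : E)) := contDiff_const
  have zD : ContDiff ℝ ∞ (fun _ : ℝ => (0 : StrongDual ℝ E)) := contDiff_const
  have hstate := eq_zero_of_integral_apply_eq_zero hab
    (continuousOn_residual I G hI hΩ hξ hγ hden) fun x hx _ _ => by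
      simpa [firstVariation] using h0 x _ _ 0 0 hx zE zD rfl
  have hcostate := eq_zero_of_integral_apply_eq_zero hab
    (continuousOn_costateResidual I G hI hκ hΩ hξ hγ hC hden) fun x hx hxa hxb => by
      simpa [firstVariation, hxa, hxb] using h0 _ x _ 0 0 zE hx zD hxa
  have hcontrol := eq_zero_of_integral_apply_eq_zero hab
    (continuousOn_controlResidual I G hI hκ hΩ hξ hγ hC hden) fun x hx hxa hxb => by
      simpa [firstVariation, hxa, hxb] using h0 _ _ x 0 0 zE zE hx rfl
  have hint : ∀ x : ℝ → StrongDual ℝ E,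
      ∫ t in P.a..b, P.controlResidual I G κ Ω ξ t (x t) = 0 := fun x => by
    rw [intervalIntegral.integral_congr (g := fun _ => (0 : ℝ)) fun t ht => by
      rw [Set.uIcc_of_le hab.le] at ht
      simp [hcontrol t ht]]
    simp
  have hend : ∀ x : ℝ → StrongDual ℝ E, ContDiff ℝ ∞ x →
      P.controlMomentum I G κ Ω ξ b (x b) = P.controlMomentum I G κ Ω ξ P.a (x P.a) :=
    fun x hx => by
      have := h0 _ _ x 0 0 zE zE hx rfl
      simp only [firstVariation, hint] at this
      simpa [sub_eq_zero] using this
  have hba : b - P.a ≠ 0 := sub_ne_zero.mpr hab.ne'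
  refine ⟨hstate, hcostate, hcontrol, ?_, ?_, ?_, ?_⟩
  · refine sub_eq_zero.mp ((SeparatingDual.eq_zero_iff_forall_dual_eq_zero (R := ℝ) _).mpr fun g => ?_)
    simpa [firstVariation] using h0 _ _ _ g 0 zE zE zD rfl
  · ext η
    have := hend (fun t => (b - t) • η) (by fun_prop)
    simpa [hba] using this.symm
  · refine sub_eq_zero.mp ((SeparatingDual.eq_zero_iff_forall_dual_eq_zero (R := ℝ) _).mpr fun g => ?_)
    simpa [firstVariation] using h0 _ _ _ 0 g zE zE zD rfl
  · ext η
    have := hend (fun t => (t - P.a) • η) (by fun_prop)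
    simpa [hba] using this

theorem firstVariation_eq {ρ ν dρ dν : StrongDual ℝ E} {db : ℝ} (hδΩ : δΩ P.a = 0)
    (h : P.IsOptimallyControlled I G κ Ω ξ b) :
    P.firstVariation I G κ Ω ξ ρ ν b δκ δΩ δξ dρ dν db
      = ν (δΩ b) + P.momentumΩ κ Ω ξ b (δΩ b)
        + db * (ν (deriv Ω b) + P.C (Ω b, deriv Ω b, ξ b, deriv ξ b, b)) := by
  have hint : ∀ {X : Type _} [NormedAddCommGroup X] [NormedSpace ℝ X]
      (A : ℝ → StrongDual ℝ X) (x : ℝ → X), (∀ t ∈ Set.Icc P.a b, A t = 0) →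
        ∫ t in P.a..b, A t (x t) = 0 := fun A x hA => by
    rw [intervalIntegral.integral_congr (g := fun _ => (0 : ℝ)) fun t ht => by
      rw [Set.uIcc_of_le hab.le] at ht
      simp [hA t ht]]
    simp
  have hb : P.residual I G Ω ξ b = 0 := h.state b (Set.right_mem_Icc.mpr hab.le)
  rw [firstVariation, hint (P.residual I G Ω ξ) δκ h.state,
    hint (P.costateResidual I G κ Ω ξ) δΩ h.costate,
    hint (P.controlResidual I G κ Ω ξ) δξ h.control, h.left_state, h.right_state,
    h.left_control, h.right_control, hb, hδΩ]
  simp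
  ring

theorem isStationaryFixedTime_of_isOptimallyControlled
    (h : P.IsOptimallyControlled I G κ Ω ξ b) :
    P.IsStationaryFixedTime I G κ Ω ξ 0 (-P.momentumΩ κ Ω ξ b) b := by
  intro δκ δΩ δξ dρ dν h1 h2 h3 h4
  rw [differentialVanishes_iff I G hI hκ hΩ hξ hγ hC hden hab h1 h2 h3,
    firstVariation_eq I G hI hκ hΩ hξ hγ hC hden hab h4 h]
  simp

theorem isStationaryFreeTime_of_isOptimallyControlled
    (h : P.IsOptimallyControlled I G κ Ω ξ b) (hT : P.Transversality I G κ Ω ξ b) :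
    P.IsStationaryFreeTime I G κ Ω ξ 0 (-P.momentumΩ κ Ω ξ b) b := by
  intro δκ δΩ δξ dρ dν db h1 h2 h3 h4
  rw [transversality_iff I G hI (hΩ.differentiable (by simp) b)
    (h.state b (Set.right_mem_Icc.mpr hab.le))] at hT
  rw [differentialVanishes_iff I G hI hκ hΩ hξ hγ hC hden hab h1 h2 h3,
    firstVariation_eq I G hI hκ hΩ hξ hγ hC hden hab h4 h, hT]
  simp

theorem transversality_of_isStationaryFreeTime {ρ ν : StrongDual ℝ E}
    (hs : P.IsStationaryFreeTime I G κ Ω ξ ρ ν b)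
    (h : P.IsOptimallyControlled I G κ Ω ξ b) : P.Transversality I G κ Ω ξ b := by
  have zE : ContDiff ℝ ∞ (fun _ : ℝ => (0 : E)) := contDiff_const
  have zD : ContDiff ℝ ∞ (fun _ : ℝ => (0 : StrongDual ℝ E)) := contDiff_const
  have h0 : ∀ (x : ℝ → E) (db : ℝ), ContDiff ℝ ∞ x → x P.a = 0 →
      ν (x b) + P.momentumΩ κ Ω ξ b (x b)
        + db * (ν (deriv Ω b) + P.C (Ω b, deriv Ω b, ξ b, deriv ξ b, b)) = 0 :=
    fun x db hx hxa => by
      rw [← firstVariation_eq I G hI hκ hΩ hξ hγ hC hden hab (ρ := ρ) (dρ := 0) (dν := 0)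
        (δκ := fun _ => 0) (δξ := fun _ => 0) hxa h]
      exact (differentialVanishes_iff I G hI hκ hΩ hξ hγ hC hden hab zE hx zD).mp
        (hs _ x _ 0 0 db zE hx zD hxa)
  have hba : b - P.a ≠ 0 := sub_ne_zero.mpr hab.ne'
  have h1 := h0 (fun t => ((t - P.a) / (b - P.a)) • deriv Ω b) 0 (by fun_prop) (by simp)
  have h2 := h0 (fun _ => 0) 1 zE rfl
  rw [transversality_iff I G hI (hΩ.differentiable (by simp) b)
    (h.state b (Set.right_mem_Icc.mpr hab.le))]
  simp only [div_self hba, one_smul, zero_mul, add_zero] at h1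
  simp only [map_zero, zero_add, one_mul] at h2
  linarith

end Stationarity

end ControlProblem

end Suslov

end

theorem mainTheorem2
    {E : Type*} [NormedAddCommGroup E] [NormedSpace ℝ E] [FiniteDimensional ℝ E]
    {H : Type*} [TopologicalSpace H] (I : ModelWithCorners ℝ E H)
    (G : Type*) [TopologicalSpace G] [ChartedSpace H G] [Group G]
    [LieGroup I (minSmoothness ℝ 3) G]
    (P : Suslov.ControlProblem E)
    (hinertia : ContDiff ℝ 1 (fun t => (P.inertia t : E →L[ℝ] StrongDual ℝ E)))
    (κ Ω : ℝ → E) (ξ : ℝ → StrongDual ℝ E) (b : ℝ) (hab : P.a < b)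
    (hκ : ContDiff ℝ 1 κ) (hΩ : ContDiff ℝ 2 Ω) (hξ : ContDiff ℝ 2 ξ)
    (hγ : ∀ t ∈ Set.Icc P.a b, ContDiffAt ℝ 2 P.γ (ξ t, t))
    (hC : ∀ t ∈ Set.Icc P.a b, ContDiffAt ℝ 2 P.C (Ω t, deriv Ω t, ξ t, deriv ξ t, t))
    (hden : ∀ t ∈ Set.Icc P.a b, ξ t (Suslov.invAdjoint (P.inertia t) (ξ t)) ≠ 0) :
    ((∃ ρ ν : StrongDual ℝ E, P.IsStationaryFixedTime I G κ Ω ξ ρ ν b) ↔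
        P.IsOptimallyControlled I G κ Ω ξ b) ∧
      ((∃ ρ ν : StrongDual ℝ E, P.IsStationaryFreeTime I G κ Ω ξ ρ ν b) ↔
        (P.IsOptimallyControlled I G κ Ω ξ b ∧ P.Transversality I G κ Ω ξ b)) := by
  refine ⟨⟨?_, fun h => ⟨0, -P.momentumΩ κ Ω ξ b, ?_⟩⟩,
    ⟨?_, fun h => ⟨0, -P.momentumΩ κ Ω ξ b, ?_⟩⟩⟩
  · rintro ⟨ρ, ν, h⟩
    exact Suslov.ControlProblem.isOptimallyControlled_of_isStationary I G hinertia hκ hΩ hξ hγ hC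
      hden hab h
  · exact Suslov.ControlProblem.isStationaryFixedTime_of_isOptimallyControlled I G hinertia hκ hΩ
      hξ hγ hC hden hab h
  · rintro ⟨ρ, ν, h⟩
    have h' := Suslov.ControlProblem.isOptimallyControlled_of_isStationary I G hinertia hκ hΩ hξ
      hγ hC hden hab (fun δκ δΩ δξ dρ dν => h δκ δΩ δξ dρ dν 0)
    exact ⟨h', Suslov.ControlProblem.transversality_of_isStationaryFreeTime I G hinertia hκ hΩ hξ
      hγ hC hden hab h h'⟩
  · exact Suslov.ControlProblem.isStationaryFreeTime_of_isOptimallyControlled I G hinertia hκ hΩ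
      hξ hγ hC hden hab h.1 h.2
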